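/- **Setting.** For each $n\ge1$ let $X$ be an $n\times p$ real design matrix, $p=p_n$, which is either deterministic or random and independent of the error vector $\epsilon\sim N(0,\sigma_0^2I_n)$, $\sigma_0>0$. A model is a subset $\gamma\subseteq\{1,\dots,p\}$; $X_\gamma$ denotes the submatrix of the columns of $X$ with index in $\gamma$. Consider the hierarchical Bayesian model $$\mathbf y\mid\beta,\sigma^2\sim N(X\beta,\sigma^2I_n),\qquad \beta_j\mid\gamma,\sigma^2\sim\begin{cases}N(0,c_j\sigma^2)& j\in\gamma\\ \delta_0& j\notin\gamma\end{cases}\ \text{(independently over } j),\qquad 1/\sigma^2\sim\chi^2_\nu,\qquad \gamma\sim p(\gamma),$$ where $\nu>0$ is fixed, $c_1,\dots,c_p>0$ are hyperparameters, $\delta_0$ is here the point mass at $0$, and $p(\cdot)$ is a probability distribution on the models, which may depend on $n$. Let $p(\gamma\mid Z)$ be the resulting posterior probability of $\gamma$ given $Z=(\mathbf y,X)$. **Theorem.** Suppose that the true model is the null model $\emptyset$, i.e. the data are $\mathbf y=\epsilon$, and that: 1. there is a constant $C_0>0$ with $\max_\gamma p(\gamma)/p(\emptyset)\le C_0$ for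 all $n$; 2. $p\to\infty$, $p\le n$ for all $n$, and $p\log p=o(n)$ as $n\to\infty$; 3. $0<\underline\phi_n\le\bar\phi_n$ for all $n$, and $\bar\phi_n=O(n^{\kappa})$ for some constant $\kappa>0$; 4. there are constants $C_3>0$ and $\delta\ge0$ such that $n^{1-\delta}\underline\phi_n\to\infty$ and, for every $n$, almost surely $$\lambda_{\min}\!\left(\tfrac1nX_\gamma^TX_\gamma\right)\ge C_3n^{-\delta}\qquad\text{for all }\gamma\ne\emptyset .$$ Let $\delta$ be as in 4. Then, as $n\to\infty$: * if $p^{\alpha_0}=o(n^{1-\delta}\underline\phi_n)$ for some $\alpha_0>2$, then $$\sup_{c_1,\dots,c_p\in[\underline\phi_n,\bar\phi_n]}\ \max_{\gamma\ne\emptyset}\frac{p(\gamma\mid Z)}{p(\emptyset\mid Z)}\to0\quad\text{in probability};$$ * if $p^{\alpha_0+2}=o(n^{1-\delta}\underline\phi_n)$ for some $\alpha_0>2$, then $$\sup_{c_1,\dots,c_p\in[\underline\phi_n,\bar\phi_n]}\ \sum_{\gamma\ne\emptyset}p(\gamma\mid Z)\to0\quad\text{and}\quad\inf_{c_1,\dots,c_p\in[\underline\phi_n,\bar\phi_n]}p(\emptyset\mid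 Z)\to1\quad\text{in probability}.$$ -/

import Mathlib

open MeasureTheory ProbabilityTheory Filter Asymptotics
open scoped Topology ENNReal NNReal

namespace BayesSelection

noncomputable section

/-! A model (state vector) on `p` covariates is the set `γ : Finset (Fin p)` of the indices of its
nonzero coordinates; the null model is `∅`. -/

/-- The submatrix `X_s` of the columns of `X` indexed by `s`. -/
def cols {n p : ℕ} (X : Matrix (Fin n) (Fin p) ℝ) (s : Finset (Fin p)) :
    Matrix (Fin n) {j // j ∈ s} ℝ :=
  X.submatrix id Subtype.val

/-- `P_γ = X_γ (X_γᵀ X_γ)⁻¹ X_γᵀ`; this is `0` for `γ = ∅`. -/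
def projMatrix {n p : ℕ} (X : Matrix (Fin n) (Fin p) ℝ) (γ : Finset (Fin p)) :
    Matrix (Fin n) (Fin n) ℝ :=
  cols X γ * ((cols X γ).transpose * cols X γ)⁻¹ * (cols X γ).transpose

/-- The minimal (real) eigenvalue of a square matrix. It is used only for symmetric matrices of
positive size, whose spectrum is a nonempty finite set of reals. -/
def minEigenvalue {ι : Type*} [Fintype ι] [DecidableEq ι] (A : Matrix ι ι ℝ) : ℝ :=
  sInf (spectrum ℝ A)

/-- `n⁻¹ X_{γ∖γ₀}ᵀ (I - P_{γ₀}) X_{γ∖γ₀}`. -/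
def residualGram {n p : ℕ} (X : Matrix (Fin n) (Fin p) ℝ) (γ₀ γ : Finset (Fin p)) :
    Matrix {j // j ∈ γ \ γ₀} {j // j ∈ γ \ γ₀} ℝ :=
  (1 / (n : ℝ)) •
    ((cols X (γ \ γ₀)).transpose * (1 - projMatrix X γ₀) * cols X (γ \ γ₀))

/-- The chi-square distribution with `ν` degrees of freedom. -/
def chiSquare (ν : ℝ) : Measure ℝ := gammaMeasure (ν / 2) (1 / 2)

/-- The density at `y` of `N(X β, σ² I_n)`, with `v = σ²`. -/
def likelihood {n p : ℕ} (X : Matrix (Fin n) (Fin p) ℝ) (β : Fin p → ℝ) (v : ℝ)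
    (y : Fin n → ℝ) : ℝ≥0∞ :=
  ∏ i, gaussianPDF (X.mulVec β i) v.toNNReal (y i)

/-- The conditional prior of `β` given `γ` and `v = σ²`: the coordinates are independent, with
law `N(0, c_j σ²)` for `j ∈ γ` and a point mass at `0` for `j ∉ γ`. -/
def coefPrior {p : ℕ} (c : Fin p → ℝ) (γ : Finset (Fin p)) (v : ℝ) : Measure (Fin p → ℝ) :=
  Measure.pi fun j => if j ∈ γ then gaussianReal 0 (c j * v).toNNReal else Measure.dirac 0

/-- The marginal density of `y` under the model `γ`: the likelihood with `β` and `σ²` integrated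
out, where `τ = 1 / σ²` has a chi-square law with `ν` degrees of freedom. -/
def marginal {n p : ℕ} (ν : ℝ) (c : Fin p → ℝ) (X : Matrix (Fin n) (Fin p) ℝ)
    (y : Fin n → ℝ) (γ : Finset (Fin p)) : ℝ≥0∞ :=
  ∫⁻ τ, ∫⁻ β, likelihood X β τ⁻¹ y ∂(coefPrior c γ τ⁻¹) ∂(chiSquare ν)

/-- The posterior probability `p(γ | Z)`, `Z = (y, X)`, for the prior `π` on models. -/
def posterior {n p : ℕ} (π : PMF (Finset (Fin p))) (ν : ℝ) (c : Fin p → ℝ)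
    (X : Matrix (Fin n) (Fin p) ℝ) (y : Fin n → ℝ) (γ : Finset (Fin p)) : ℝ≥0∞ :=
  π γ * marginal ν c X y γ / ∑ γ', π γ' * marginal ν c X y γ'

/-- The hyperparameters `c` with `c_1, …, c_p ∈ [a, b]`. -/
def hyperBox (p : ℕ) (a b : ℝ) : Set (Fin p → ℝ) := {c | ∀ j, c j ∈ Set.Icc a b}

/-- `sup_c max_{γ ≠ γ₀} p(γ | Z) / p(γ₀ | Z)`. -/
def supOdds {n p : ℕ} (π : PMF (Finset (Fin p))) (ν a b : ℝ) (γ₀ : Finset (Fin p))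
    (X : Matrix (Fin n) (Fin p) ℝ) (y : Fin n → ℝ) : ℝ≥0∞ :=
  ⨆ c ∈ hyperBox p a b, ⨆ γ : Finset (Fin p), ⨆ _ : γ ≠ γ₀,
    posterior π ν c X y γ / posterior π ν c X y γ₀

/-- `sup_c ∑_{γ ≠ γ₀} p(γ | Z)`. -/
def supWrong {n p : ℕ} (π : PMF (Finset (Fin p))) (ν a b : ℝ) (γ₀ : Finset (Fin p))
    (X : Matrix (Fin n) (Fin p) ℝ) (y : Fin n → ℝ) : ℝ≥0∞ :=
  ⨆ c ∈ hyperBox p a b, ∑ γ ∈ Finset.univ.erase γ₀, posterior π ν c X y γ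

/-- `inf_c p(γ₀ | Z)`. -/
def infTrue {n p : ℕ} (π : PMF (Finset (Fin p))) (ν a b : ℝ) (γ₀ : Finset (Fin p))
    (X : Matrix (Fin n) (Fin p) ℝ) (y : Fin n → ℝ) : ℝ≥0∞ :=
  ⨅ c ∈ hyperBox p a b, posterior π ν c X y γ₀

end

end BayesSelection

/-!
Let `r` be a lower bound on the least eigenvalue of `Xᵀ X` and `a` one on the `c_j`. Completing the
square around the least squares fit and integrating out the coefficients and then `σ²` bounds the
ratio of the marginal density of the model `γ` to that of the null model by
`(r a) ^ (-|γ| / 2) * ((1 + |ε|²) / (1 + εᵀ (I - P_γ) ε)) ^ ((n + ν) / 2)`.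

Chernoff bounds for `χ²` variables and a union bound over the models show that, with high
probability, `εᵀ P_γ ε ≤ 2 (1 + η) σ₀² |γ| log p` for all `γ` simultaneously and
`|ε|² ≥ (1 - η) n σ₀²`. As `p log p = o(n)`, the power in the ratio is then at most `p ^ (q |γ|)`,
for any fixed `q > 1` and `η` small, so the posterior odds against the null model are at most
`C₀ x ^ |γ|` with `x = p ^ q / √(r a)`. With `q = α₀ / 2` this gives the first claim. By the
binomial theorem the odds sum to at most `C₀ (exp (p x) - 1)`, whence the additional factor `p`
(that is, `p ^ 2` before taking the square root) in the second.
-/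

namespace BayesSelection

open Matrix

/-- The least eigenvalue of `Aᵀ A` is at least `r`, expressed through the Rayleigh quotient so that
it makes sense for any number of columns, including zero. -/
def GramBound {m ι : Type*} [Fintype m] [Fintype ι] (r : ℝ) (A : Matrix m ι ℝ) : Prop :=
  ∀ w : ι → ℝ, r * (w ⬝ᵥ w) ≤ (A *ᵥ w) ⬝ᵥ (A *ᵥ w)

/-- The least squares coefficients of the regression of `y` on the columns of `A`, given by the
normal equations; meaningful when `Aᵀ A` is invertible. -/
noncomputable def leastSquares {m ι : Type*} [Fintype m] [Fintype ι] [DecidableEq ι]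
    (A : Matrix m ι ℝ) (y : m → ℝ) : ι → ℝ :=
  (Aᵀ * A)⁻¹ *ᵥ (Aᵀ *ᵥ y)

/-- The fitted sum of squares `yᵀ P_γ y` of the model `γ`. -/
noncomputable def fittedSS {n p : ℕ} (X : Matrix (Fin n) (Fin p) ℝ) (y : Fin n → ℝ)
    (γ : Finset (Fin p)) : ℝ :=
  y ⬝ᵥ (projMatrix X γ *ᵥ y)

/-- The residual sum of squares `yᵀ (I - P_γ) y` of the model `γ`. -/
noncomputable def residualSS {n p : ℕ} (X : Matrix (Fin n) (Fin p) ℝ) (y : Fin n → ℝ)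
    (γ : Finset (Fin p)) : ℝ :=
  y ⬝ᵥ y - fittedSS X y γ

section LinearAlgebra

variable {m ι : Type*} [Fintype m] [Fintype ι]

lemma dotProduct_self_nonneg (v : ι → ℝ) : 0 ≤ v ⬝ᵥ v := by
  simpa only [star_trivial] using dotProduct_star_self_nonneg v

lemma normSq_sub_of_dotProduct_eq_zero {x z : ι → ℝ} (h : x ⬝ᵥ z = 0) :
    (z - x) ⬝ᵥ (z - x) = z ⬝ᵥ z + x ⬝ᵥ x := by
  rw [sub_dotProduct, dotProduct_sub, dotProduct_sub, dotProduct_comm z x, h]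
  ring

lemma mulVec_dotProduct_eq (A : Matrix m ι ℝ) (w : ι → ℝ) (y : m → ℝ) :
    (A *ᵥ w) ⬝ᵥ y = w ⬝ᵥ (Aᵀ *ᵥ y) := by
  rw [mulVec_transpose, dotProduct_comm w, ← dotProduct_mulVec, dotProduct_comm]

variable [DecidableEq ι]

lemma dotProduct_residual_leastSquares {A : Matrix m ι ℝ} (hA : IsUnit (Aᵀ * A).det) (y : m → ℝ)
    (u : ι → ℝ) : (A *ᵥ u) ⬝ᵥ (y - A *ᵥ leastSquares A y) = 0 := by
  rw [mulVec_dotProduct_eq, mulVec_sub, leastSquares, mulVec_mulVec, mulVec_mulVec,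
    mul_nonsing_inv _ hA, one_mulVec, sub_self, dotProduct_zero]

lemma normSq_residual_leastSquares {A : Matrix m ι ℝ} (hA : IsUnit (Aᵀ * A).det) (y : m → ℝ) :
    (y - A *ᵥ leastSquares A y) ⬝ᵥ (y - A *ᵥ leastSquares A y) =
      y ⬝ᵥ y - y ⬝ᵥ ((A * (Aᵀ * A)⁻¹ * Aᵀ) *ᵥ y) := by
  have hfit : (A * (Aᵀ * A)⁻¹ * Aᵀ) *ᵥ y = A *ᵥ leastSquares A y := by
    simp only [leastSquares, mulVec_mulVec, Matrix.mul_assoc]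
  rw [sub_dotProduct, dotProduct_residual_leastSquares hA, sub_zero, dotProduct_sub, hfit]

lemma normSq_sub_mulVec {A : Matrix m ι ℝ} (hA : IsUnit (Aᵀ * A).det) (y : m → ℝ) (w : ι → ℝ) :
    (y - A *ᵥ w) ⬝ᵥ (y - A *ᵥ w) =
      (y - A *ᵥ leastSquares A y) ⬝ᵥ (y - A *ᵥ leastSquares A y) +
        (A *ᵥ (w - leastSquares A y)) ⬝ᵥ (A *ᵥ (w - leastSquares A y)) := by
  have hsplit : y - A *ᵥ w = (y - A *ᵥ leastSquares A y) - A *ᵥ (w - leastSquares A y) := by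
    rw [mulVec_sub]
    abel
  rw [hsplit]
  exact normSq_sub_of_dotProduct_eq_zero (dotProduct_residual_leastSquares hA y _)

lemma exists_isometry_factor {A : Matrix m ι ℝ} (hA : IsUnit (Aᵀ * A).det) :
    ∃ U : Matrix m ι ℝ, Uᵀ * U = 1 ∧ A * (Aᵀ * A)⁻¹ * Aᵀ = U * Uᵀ := by
  obtain ⟨B, hB⟩ : ∃ B : Matrix ι ι ℝ, Aᵀ * A = Bᵀ * B := by
    open scoped MatrixOrder in
    obtain ⟨B, hB⟩ := CStarAlgebra.nonneg_iff_eq_star_mul_self.mp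
      (posSemidef_conjTranspose_mul_self A).nonneg
    exact ⟨B, by simpa only [star_eq_conjTranspose, conjTranspose_eq_transpose_of_trivial] using hB⟩
  have hBu : IsUnit B.det := by
    rw [hB, det_mul] at hA
    exact isUnit_of_mul_isUnit_right hA
  refine ⟨A * B⁻¹, ?_, ?_⟩
  · rw [transpose_mul, transpose_nonsing_inv, Matrix.mul_assoc, ← Matrix.mul_assoc Aᵀ, hB,
      Matrix.mul_assoc, mul_nonsing_inv _ hBu, Matrix.mul_one, nonsing_inv_mul]
    rwa [det_transpose]
  · rw [transpose_mul, transpose_nonsing_inv, hB, Matrix.mul_inv_rev]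
    simp only [Matrix.mul_assoc]

lemma GramBound.isUnit_det {r : ℝ} (hr : 0 < r) {A : Matrix m ι ℝ} (h : GramBound r A) :
    IsUnit (Aᵀ * A).det := by
  have hinj : Function.Injective A.mulVec := by
    intro u v huv
    have hle := h (u - v)
    rw [mulVec_sub, sub_eq_zero.mpr huv, zero_dotProduct] at hle
    have hzero : (u - v) ⬝ᵥ (u - v) = 0 :=
      le_antisymm (nonpos_of_mul_nonpos_right hle hr) (dotProduct_self_nonneg _)
    exact sub_eq_zero.mp (dotProduct_self_eq_zero.mp hzero)
  have hpos := (PosDef.conjTranspose_mul_self A hinj).det_pos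
  rw [conjTranspose_eq_transpose_of_trivial] at hpos
  exact hpos.ne'.isUnit

lemma minEigenvalue_mul_dotProduct_le {A : Matrix ι ι ℝ} (hA : A.IsHermitian) (v : ι → ℝ) :
    minEigenvalue A * (v ⬝ᵥ v) ≤ v ⬝ᵥ (A *ᵥ v) := by
  have hle : ∀ x ∈ spectrum ℝ A, minEigenvalue A ≤ x := fun x hx =>
    csInf_le A.finite_real_spectrum.bddBelow hx
  have hps : (A - algebraMap ℝ _ (minEigenvalue A)).PosSemidef := by
    open scoped MatrixOrder in
    exact algebraMap_le_of_le_spectrum hle hA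
  have hnonneg := hps.dotProduct_mulVec_nonneg v
  rw [star_trivial, Algebra.algebraMap_eq_smul_one, sub_mulVec, smul_mulVec, one_mulVec,
    dotProduct_sub, dotProduct_smul, smul_eq_mul] at hnonneg
  linarith

end LinearAlgebra

section Design

variable {n p : ℕ}

lemma projMatrix_empty (X : Matrix (Fin n) (Fin p) ℝ) : projMatrix X ∅ = 0 := by
  ext i j
  simp [projMatrix, Matrix.mul_apply]

lemma fittedSS_empty (X : Matrix (Fin n) (Fin p) ℝ) (y : Fin n → ℝ) : fittedSS X y ∅ = 0 := by
  rw [fittedSS, projMatrix_empty, zero_mulVec, dotProduct_zero]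

lemma mulVec_eq_cols_mulVec (X : Matrix (Fin n) (Fin p) ℝ) {γ : Finset (Fin p)} {β : Fin p → ℝ}
    (hβ : ∀ j ∉ γ, β j = 0) : X *ᵥ β = cols X γ *ᵥ fun j => β j := by
  ext i
  simp only [mulVec, dotProduct, cols, submatrix_apply, id]
  rw [Finset.sum_coe_sort γ (fun j => X i j * β j)]
  refine (Finset.sum_subset (Finset.subset_univ γ) fun j _ hj => ?_).symm
  rw [hβ j hj, mul_zero]

lemma dotProduct_self_eq_restrict {γ : Finset (Fin p)} {β : Fin p → ℝ}
    (hβ : ∀ j ∉ γ, β j = 0) : β ⬝ᵥ β = (fun j : {j // j ∈ γ} => β j) ⬝ᵥ fun j => β j := by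
  simp only [dotProduct]
  rw [Finset.sum_coe_sort γ (fun j => β j * β j)]
  refine (Finset.sum_subset (Finset.subset_univ γ) fun j _ hj => ?_).symm
  rw [hβ j hj, mul_zero]

lemma GramBound.cols {X : Matrix (Fin n) (Fin p) ℝ} {r : ℝ} (h : GramBound r X)
    (γ : Finset (Fin p)) : GramBound r (cols X γ) := by
  intro w
  set β : Fin p → ℝ := Function.extend Subtype.val w 0
  have hrestrict : (fun j : {j // j ∈ γ} => β j) = w :=
    funext fun j => Subtype.val_injective.extend_apply w 0 j
  have hzero : ∀ j ∉ γ, β j = 0 := fun j hj =>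
    Function.extend_apply' _ _ _ fun ⟨i, hi⟩ => hj (hi ▸ i.2)
  have hbound := h β
  rwa [mulVec_eq_cols_mulVec X hzero, dotProduct_self_eq_restrict hzero, hrestrict] at hbound

lemma dotProduct_residualGram_empty_mulVec (X : Matrix (Fin n) (Fin p) ℝ) (γ : Finset (Fin p))
    (w : {j // j ∈ γ \ ∅} → ℝ) :
    w ⬝ᵥ (residualGram X ∅ γ *ᵥ w) =
      1 / n * ((cols X (γ \ ∅) *ᵥ w) ⬝ᵥ (cols X (γ \ ∅) *ᵥ w)) := by
  rw [residualGram, projMatrix_empty, sub_zero, Matrix.mul_one, smul_mulVec, dotProduct_smul,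
    smul_eq_mul, mulVec_dotProduct_eq, mulVec_mulVec]

lemma isHermitian_residualGram_empty (X : Matrix (Fin n) (Fin p) ℝ) (γ : Finset (Fin p)) :
    (residualGram X ∅ γ).IsHermitian := by
  rw [residualGram, projMatrix_empty, sub_zero, Matrix.mul_one]
  exact (isHermitian_conjTranspose_mul_self _).smul (IsSelfAdjoint.all _)

lemma gramBound_of_le_minEigenvalue (hn : 0 < n) {X : Matrix (Fin n) (Fin p) ℝ} {l : ℝ}
    (h : l ≤ minEigenvalue (residualGram X ∅ Finset.univ)) : GramBound (n * l) X := by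
  intro β
  have hmem : ∀ j ∉ (Finset.univ \ ∅ : Finset (Fin p)), β j = 0 := by simp
  have hmin := minEigenvalue_mul_dotProduct_le (isHermitian_residualGram_empty X Finset.univ)
    fun j => β j
  rw [dotProduct_residualGram_empty_mulVec, ← dotProduct_self_eq_restrict hmem,
    ← mulVec_eq_cols_mulVec X hmem] at hmin
  have hl := (mul_le_mul_of_nonneg_right h (dotProduct_self_nonneg β)).trans hmin
  rwa [one_div, ← div_eq_inv_mul, le_div_iff₀ (Nat.cast_pos.mpr hn), mul_right_comm,
    mul_comm l] at hl

lemma gramBound_rpow_of_le_minEigenvalue (hn : 0 < n) {X : Matrix (Fin n) (Fin p) ℝ} {C δ : ℝ}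
    (h : ∀ γ : Finset (Fin p), γ ≠ ∅ →
      C * (n : ℝ) ^ (-δ) ≤ minEigenvalue (residualGram X ∅ γ)) :
    GramBound (C * (n : ℝ) ^ (1 - δ)) X := by
  obtain hp | hp := Finset.eq_empty_or_nonempty (Finset.univ : Finset (Fin p))
  · intro w
    simp only [dotProduct, mulVec, hp, Finset.sum_empty, mul_zero, Finset.sum_const_zero, le_refl]
  · have hrpow : C * (n : ℝ) ^ (1 - δ) = n * (C * (n : ℝ) ^ (-δ)) := by
      rw [sub_eq_add_neg, Real.rpow_add (Nat.cast_pos.mpr hn), Real.rpow_one, mul_left_comm]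
    rw [hrpow]
    exact gramBound_of_le_minEigenvalue hn (h _ hp.ne_empty)

lemma normSq_sub_mulVec_leastSquares_cols {X : Matrix (Fin n) (Fin p) ℝ} {γ : Finset (Fin p)}
    (hγ : IsUnit ((cols X γ)ᵀ * cols X γ).det) (y : Fin n → ℝ) :
    (y - cols X γ *ᵥ leastSquares (cols X γ) y) ⬝ᵥ (y - cols X γ *ᵥ leastSquares (cols X γ) y) =
      residualSS X y γ :=
  normSq_residual_leastSquares hγ y

lemma residualSS_nonneg {X : Matrix (Fin n) (Fin p) ℝ} {γ : Finset (Fin p)}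
    (hγ : IsUnit ((cols X γ)ᵀ * cols X γ).det) (y : Fin n → ℝ) : 0 ≤ residualSS X y γ := by
  rw [← normSq_sub_mulVec_leastSquares_cols hγ]
  exact dotProduct_self_nonneg _

lemma exists_residualSS_add_le_normSq {X : Matrix (Fin n) (Fin p) ℝ} {r : ℝ} (hr : 0 < r)
    (h : GramBound r X) (y : Fin n → ℝ) (γ : Finset (Fin p)) :
    ∃ b : Fin p → ℝ, ∀ β : Fin p → ℝ, (∀ j ∉ γ, β j = 0) →
      residualSS X y γ + r * ∑ j ∈ γ, (β j - b j) ^ 2 ≤ (y - X *ᵥ β) ⬝ᵥ (y - X *ᵥ β) := by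
  have hunit := (h.cols γ).isUnit_det hr
  set b := leastSquares (cols X γ) y with hb
  refine ⟨Function.extend Subtype.val b 0, fun β hβ => ?_⟩
  have hsum : ∑ j ∈ γ, (β j - Function.extend Subtype.val b 0 j) ^ 2 =
      ((fun j : {j // j ∈ γ} => β j) - b) ⬝ᵥ ((fun j : {j // j ∈ γ} => β j) - b) := by
    rw [← Finset.sum_coe_sort γ, dotProduct]
    exact Finset.sum_congr rfl fun j _ => by
      rw [Subtype.val_injective.extend_apply, sq, Pi.sub_apply]
  rw [hsum, mulVec_eq_cols_mulVec X hβ, normSq_sub_mulVec hunit,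
    normSq_sub_mulVec_leastSquares_cols hunit, ← hb]
  gcongr
  exact h.cols γ _

end Design

section GaussianIntegrals

lemma lintegral_exp_neg_mul_sq_sub {s : ℝ} (hs : 0 < s) (b : ℝ) :
    ∫⁻ x : ℝ, ENNReal.ofReal (Real.exp (-s * (x - b) ^ 2)) = ENNReal.ofReal √(Real.pi / s) := by
  rw [lintegral_sub_right_eq_self (fun x : ℝ => ENNReal.ofReal (Real.exp (-s * x ^ 2))) b,
    ← integral_gaussian s, ofReal_integral_eq_lintegral_ofReal (integrable_exp_neg_mul_sq hs)]
  exact Eventually.of_forall fun x => (Real.exp_pos _).le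

lemma lintegral_inv_sqrt_mul_exp_neg_mul_sq_sub {u v : ℝ} (hu : 0 < u) (hv : 0 < v) (b : ℝ) :
    ∫⁻ x : ℝ, ENNReal.ofReal (√(2 * Real.pi * v))⁻¹ *
        ENNReal.ofReal (Real.exp (-(u / (2 * v)) * (x - b) ^ 2)) =
      ENNReal.ofReal (√u)⁻¹ := by
  rw [lintegral_const_mul _ (by fun_prop), lintegral_exp_neg_mul_sq_sub (by positivity),
    ← ENNReal.ofReal_mul (by positivity), ← Real.sqrt_inv, ← Real.sqrt_inv,
    ← Real.sqrt_mul (by positivity)]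
  congr 2
  field_simp

lemma lintegral_gaussianReal_eq {v : ℝ≥0} (hv : v ≠ 0) {f : ℝ → ℝ≥0∞} (hf : Measurable f) :
    ∫⁻ x, f x ∂(gaussianReal 0 v) = ∫⁻ x, ENNReal.ofReal (√(2 * Real.pi * v))⁻¹ *
      (ENNReal.ofReal (Real.exp (-x ^ 2 / (2 * v))) * f x) := by
  rw [gaussianReal_of_var_ne_zero _ hv,
    lintegral_withDensity_eq_lintegral_mul _ (measurable_gaussianPDF _ _) hf]
  refine lintegral_congr fun x => ?_
  rw [Pi.mul_apply, gaussianPDF, gaussianPDFReal, sub_zero, ENNReal.ofReal_mul (by positivity),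
    mul_assoc]

lemma lintegral_exp_sq_sub_gaussianReal_le {s : ℝ} (hs : 0 < s) {v : ℝ≥0} (hv : v ≠ 0) (b : ℝ) :
    ∫⁻ x, ENNReal.ofReal (Real.exp (-s * (x - b) ^ 2 / 2)) ∂(gaussianReal 0 v) ≤
      ENNReal.ofReal (√(s * v))⁻¹ := by
  have hv' : (0 : ℝ) < v := NNReal.coe_pos.mpr hv.bot_lt
  rw [lintegral_gaussianReal_eq hv (by fun_prop),
    ← lintegral_inv_sqrt_mul_exp_neg_mul_sq_sub (mul_pos hs hv') hv' b]
  refine lintegral_mono fun x => ?_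
  gcongr
  have hexp : -s * (x - b) ^ 2 / 2 = -(s * v / (2 * v)) * (x - b) ^ 2 := by field_simp
  rw [hexp]
  refine mul_le_of_le_one_left' (ENNReal.ofReal_le_one.mpr (Real.exp_le_one_iff.mpr ?_))
  exact div_nonpos_of_nonpos_of_nonneg (neg_nonpos.mpr (sq_nonneg x)) (by positivity)

lemma lintegral_exp_sq_gaussianReal {u : ℝ} (hu : -1 < u) {v : ℝ≥0} (hv : v ≠ 0) :
    ∫⁻ x, ENNReal.ofReal (Real.exp (-u * x ^ 2 / (2 * v))) ∂(gaussianReal 0 v) =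
      ENNReal.ofReal (√(1 + u))⁻¹ := by
  have hv' : (0 : ℝ) < v := NNReal.coe_pos.mpr hv.bot_lt
  rw [lintegral_gaussianReal_eq hv (by fun_prop),
    ← lintegral_inv_sqrt_mul_exp_neg_mul_sq_sub (by linarith : 0 < 1 + u) hv' 0]
  refine lintegral_congr fun x => ?_
  rw [← ENNReal.ofReal_mul (Real.exp_pos _).le, ← Real.exp_add]
  congr 3
  ring

lemma lintegral_exp_mul_gaussianReal (v : ℝ≥0) (t : ℝ) :
    ∫⁻ x, ENNReal.ofReal (Real.exp (t * x)) ∂(gaussianReal 0 v) =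
      ENNReal.ofReal (Real.exp (v * t ^ 2 / 2)) := by
  have hmgf := congrFun (mgf_id_gaussianReal (μ := 0) (v := v)) t
  simp only [mgf, id, zero_mul, zero_add] at hmgf
  rw [← hmgf, ofReal_integral_eq_lintegral_ofReal (integrable_exp_mul_gaussianReal t)]
  exact Eventually.of_forall fun x => (Real.exp_pos _).le

lemma ofReal_exp_sum {ι : Type*} (s : Finset ι) (f : ι → ℝ) :
    ENNReal.ofReal (Real.exp (∑ i ∈ s, f i)) = ∏ i ∈ s, ENNReal.ofReal (Real.exp (f i)) := by
  rw [Real.exp_sum, ENNReal.ofReal_prod_of_nonneg fun i _ => (Real.exp_pos _).le]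

variable {ι : Type*} [Fintype ι]

lemma lintegral_finsetProd_pi {α : ι → Type*} [∀ i, MeasurableSpace (α i)]
    (μ : ∀ i, Measure (α i)) [∀ i, IsProbabilityMeasure (μ i)] {f : ∀ i, α i → ℝ≥0∞}
    (hf : ∀ i, Measurable (f i)) (s : Finset ι) :
    ∫⁻ x, ∏ i ∈ s, f i (x i) ∂(Measure.pi μ) = ∏ i ∈ s, ∫⁻ t, f i t ∂(μ i) := by
  rw [lintegral_prod_eq_prod_lintegral_of_indepFun s (fun i (x : ∀ i, α i) => f i (x i))
    (iIndepFun_pi fun i => (hf i).aemeasurable) (fun i => (hf i).comp (measurable_pi_apply i))]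
  exact Finset.prod_congr rfl fun i _ => (measurePreserving_eval μ i).lintegral_comp (hf i)

lemma lintegral_exp_dotProduct_self {u : ℝ} (hu : -1 < u) {v : ℝ≥0} (hv : v ≠ 0) :
    ∫⁻ x : ι → ℝ, ENNReal.ofReal (Real.exp (-u * (x ⬝ᵥ x) / (2 * v)))
        ∂(Measure.pi fun _ => gaussianReal 0 v) =
      ENNReal.ofReal ((√(1 + u))⁻¹ ^ Fintype.card ι) := by
  simp only [dotProduct, Finset.mul_sum, Finset.sum_div, ofReal_exp_sum, ← sq]
  rw [lintegral_finsetProd_pi (f := fun _ t =>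
    ENNReal.ofReal (Real.exp (-u * t ^ 2 / (2 * v)))) _ fun _ => by fun_prop]
  simp only [lintegral_exp_sq_gaussianReal hu hv]
  rw [Finset.prod_const, ENNReal.ofReal_pow (by positivity), Finset.card_univ]

lemma lintegral_exp_dotProduct (v : ℝ≥0) (t : ι → ℝ) :
    ∫⁻ x : ι → ℝ, ENNReal.ofReal (Real.exp (t ⬝ᵥ x)) ∂(Measure.pi fun _ => gaussianReal 0 v) =
      ENNReal.ofReal (Real.exp (v * (t ⬝ᵥ t) / 2)) := by
  simp only [dotProduct, Finset.mul_sum, Finset.sum_div, ofReal_exp_sum, ← sq]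
  rw [lintegral_finsetProd_pi (f := fun i x =>
    ENNReal.ofReal (Real.exp (t i * x))) _ fun _ => by fun_prop]
  simp only [lintegral_exp_mul_gaussianReal]

variable {m : Type*} [Fintype m]

lemma lintegral_exp_smul_dotProduct (v : ℝ≥0) (θ : ℝ) (t : ι → ℝ) :
    ∫⁻ x : ι → ℝ, ENNReal.ofReal (Real.exp (θ * (t ⬝ᵥ x)))
        ∂(Measure.pi fun _ => gaussianReal 0 v) =
      ENNReal.ofReal (Real.exp (v * θ ^ 2 * (t ⬝ᵥ t) / 2)) := by
  simp only [← smul_eq_mul θ, ← smul_dotProduct, lintegral_exp_dotProduct]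
  rw [smul_dotProduct, dotProduct_smul, smul_eq_mul, smul_eq_mul, ← mul_assoc θ, ← sq,
    ← mul_assoc (v : ℝ)]

variable [DecidableEq ι]

lemma lintegral_exp_isometry_sq {U : Matrix m ι ℝ} (hU : Uᵀ * U = 1) {v : ℝ≥0} (hv : v ≠ 0)
    {s : ℝ} (hs0 : 0 ≤ s) (hs1 : s < 1) :
    ∫⁻ e : m → ℝ, ENNReal.ofReal (Real.exp (s * ((Uᵀ *ᵥ e) ⬝ᵥ (Uᵀ *ᵥ e)) / (2 * v)))
        ∂(Measure.pi fun _ => gaussianReal 0 v) =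
      ENNReal.ofReal ((√(1 - s))⁻¹ ^ Fintype.card ι) := by
  have hv' : (v : ℝ) ≠ 0 := NNReal.coe_ne_zero.mpr hv
  have hθ : √(s / v) ^ 2 = s / v := Real.sq_sqrt (by positivity)
  -- The square is linearized by an auxiliary standard Gaussian vector `z`.
  have hlinearize : ∀ e : m → ℝ,
      ENNReal.ofReal (Real.exp (s * ((Uᵀ *ᵥ e) ⬝ᵥ (Uᵀ *ᵥ e)) / (2 * v))) =
        ∫⁻ z : ι → ℝ, ENNReal.ofReal (Real.exp (√(s / v) * ((Uᵀ *ᵥ e) ⬝ᵥ z)))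
          ∂(Measure.pi fun _ => gaussianReal 0 1) := fun e => by
    rw [lintegral_exp_smul_dotProduct, hθ, NNReal.coe_one]
    congr 2
    field_simp
  have hinner : ∀ z : ι → ℝ, ∫⁻ e : m → ℝ,
      ENNReal.ofReal (Real.exp (√(s / v) * ((Uᵀ *ᵥ e) ⬝ᵥ z)))
        ∂(Measure.pi fun _ => gaussianReal 0 v) =
      ENNReal.ofReal (Real.exp (-(-s) * (z ⬝ᵥ z) / (2 * (1 : ℝ≥0)))) := fun z => by
    simp only [dotProduct_comm _ z, ← mulVec_dotProduct_eq]
    rw [lintegral_exp_smul_dotProduct, hθ, mulVec_dotProduct_eq, mulVec_mulVec, hU, one_mulVec,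
      NNReal.coe_one]
    congr 2
    field_simp
  simp_rw [hlinearize]
  rw [lintegral_lintegral_swap]
  · simp_rw [hinner]
    rw [lintegral_exp_dotProduct_self (by linarith) one_ne_zero, ← sub_eq_add_neg]
  · refine Measurable.aemeasurable ?_
    refine ENNReal.measurable_ofReal.comp (Real.measurable_exp.comp (Measurable.const_mul ?_ _))
    exact (Continuous.dotProduct (by fun_prop) (by fun_prop)).measurable

lemma lintegral_exp_projection_le (A : Matrix m ι ℝ) {v : ℝ≥0} (hv : v ≠ 0)
    {s : ℝ} (hs0 : 0 ≤ s) (hs1 : s < 1) :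
    ∫⁻ e : m → ℝ, ENNReal.ofReal (Real.exp (s * (e ⬝ᵥ ((A * (Aᵀ * A)⁻¹ * Aᵀ) *ᵥ e)) / (2 * v)))
        ∂(Measure.pi fun _ => gaussianReal 0 v) ≤
      ENNReal.ofReal ((√(1 - s))⁻¹ ^ Fintype.card ι) := by
  by_cases hA : IsUnit (Aᵀ * A).det
  · obtain ⟨U, hU, hP⟩ := exists_isometry_factor hA
    rw [← lintegral_exp_isometry_sq hU hv hs0 hs1, hP]
    refine le_of_eq (lintegral_congr fun e => ?_)
    rw [← mulVec_mulVec, dotProduct_comm, mulVec_dotProduct_eq]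
  -- A singular Gram matrix has the inverse `0` by convention, so the quadratic form vanishes.
  · have hsqrt : √(1 - s) ≤ 1 := Real.sqrt_le_one.mpr (by linarith)
    have hsqrt0 : 0 < √(1 - s) := Real.sqrt_pos.mpr (by linarith)
    rw [nonsing_inv_apply_not_isUnit _ hA]
    simp only [Matrix.mul_zero, Matrix.zero_mul, zero_mulVec, dotProduct_zero, mul_zero, zero_div,
      Real.exp_zero, ENNReal.ofReal_one, lintegral_const, measure_univ, mul_one]
    exact ENNReal.one_le_ofReal.mpr (one_le_pow₀ ((one_le_inv₀ hsqrt0).mpr hsqrt))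

end GaussianIntegrals

section GammaIntegrals

lemma measurable_gammaPDF (a b : ℝ) : Measurable (gammaPDF a b) :=
  ENNReal.measurable_ofReal.comp (measurable_gammaPDFReal a b)

lemma ae_gammaMeasure_pos (a b : ℝ) : ∀ᵐ τ ∂(gammaMeasure a b), 0 < τ := by
  rw [gammaMeasure, ae_withDensity_iff (measurable_gammaPDF a b)]
  filter_upwards [Measure.ae_ne volume (0 : ℝ)] with τ hτ0 hτ
  by_contra hneg
  exact hτ (gammaPDF_of_neg (lt_of_le_of_ne (not_lt.mp hneg) hτ0))

lemma gammaPDF_mul_rpow_mul_exp {a b k s τ : ℝ} (ha : 0 < a) (hb : 0 < b) (hk : 0 < a + k)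
    (hs : 0 < b + s) (hτ : τ ≠ 0) :
    gammaPDF a b τ * ENNReal.ofReal (τ ^ k * Real.exp (-(s * τ))) =
      ENNReal.ofReal (b ^ a / Real.Gamma a * Real.Gamma (a + k) * (b + s) ^ (-(a + k))) *
        gammaPDF (a + k) (b + s) τ := by
  rcases hτ.lt_or_gt with hneg | hpos
  · rw [gammaPDF_of_neg hneg, gammaPDF_of_neg hneg, zero_mul, mul_zero]
  · have hΓ : 0 < Real.Gamma a := Real.Gamma_pos_of_pos ha
    have hΓk : 0 < Real.Gamma (a + k) := Real.Gamma_pos_of_pos hk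
    have hpow : τ ^ (a + k - 1) = τ ^ (a - 1) * τ ^ k := by
      rw [← Real.rpow_add hpos]
      ring_nf
    have hexp : Real.exp (-((b + s) * τ)) = Real.exp (-(b * τ)) * Real.exp (-(s * τ)) := by
      rw [← Real.exp_add]
      ring_nf
    rw [gammaPDF_of_nonneg hpos.le, gammaPDF_of_nonneg hpos.le,
      ← ENNReal.ofReal_mul (by positivity), ← ENNReal.ofReal_mul (by positivity), hpow, hexp,
      Real.rpow_neg hs.le]
    congr 1
    field_simp

lemma lintegral_rpow_mul_exp_gammaMeasure {a b k s : ℝ} (ha : 0 < a) (hb : 0 < b)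
    (hk : 0 < a + k) (hs : 0 < b + s) :
    ∫⁻ τ, ENNReal.ofReal (τ ^ k * Real.exp (-(s * τ))) ∂(gammaMeasure a b) =
      ENNReal.ofReal (b ^ a / Real.Gamma a * Real.Gamma (a + k) * (b + s) ^ (-(a + k))) := by
  calc ∫⁻ τ, ENNReal.ofReal (τ ^ k * Real.exp (-(s * τ))) ∂(gammaMeasure a b)
      = ∫⁻ τ, gammaPDF a b τ * ENNReal.ofReal (τ ^ k * Real.exp (-(s * τ))) :=
        lintegral_withDensity_eq_lintegral_mul _ (measurable_gammaPDF a b) (by fun_prop)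
    _ = ∫⁻ τ, ENNReal.ofReal
          (b ^ a / Real.Gamma a * Real.Gamma (a + k) * (b + s) ^ (-(a + k))) *
            gammaPDF (a + k) (b + s) τ := by
        refine lintegral_congr_ae ?_
        filter_upwards [Measure.ae_ne volume (0 : ℝ)] with τ hτ
        exact gammaPDF_mul_rpow_mul_exp ha hb hk hs hτ
    _ = ENNReal.ofReal (b ^ a / Real.Gamma a * Real.Gamma (a + k) * (b + s) ^ (-(a + k))) := by
        rw [lintegral_const_mul _ (measurable_gammaPDF _ _), lintegral_gammaPDF_eq_one hk hs,
          mul_one]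

end GammaIntegrals

/-- The marginal density of a response vector of length `n` whose residual sum of squares is `R`
for every value of the coefficients: the Gaussian density with the precision `τ = 1 / σ²`
integrated out. -/
noncomputable def precisionIntegral (n : ℕ) (ν R : ℝ) : ℝ≥0∞ :=
  ∫⁻ τ, ENNReal.ofReal ((√(2 * Real.pi * τ⁻¹))⁻¹ ^ n * Real.exp (-τ * R / 2)) ∂(chiSquare ν)

/-- The posterior is a probability vector for all hyperparameters in `[a, b]`, and its odds against
the null model are at most `C * x ^ |γ|`, uniformly over these hyperparameters. -/
def GeometricOdds {n p : ℕ} (π : PMF (Finset (Fin p))) (ν a b : ℝ) (X : Matrix (Fin n) (Fin p) ℝ)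
    (y : Fin n → ℝ) (C : ℝ≥0) (x : ℝ) : Prop :=
  ∀ c ∈ hyperBox p a b, ∑ γ, posterior π ν c X y γ = 1 ∧
    ∀ γ, posterior π ν c X y γ / posterior π ν c X y ∅ ≤ C * ENNReal.ofReal (x ^ γ.card)

section PrecisionIntegral

lemma inv_sqrt_mul_inv_pow {τ : ℝ} (hτ : 0 ≤ τ) (n : ℕ) :
    (√(2 * Real.pi * τ⁻¹))⁻¹ ^ n = (√(2 * Real.pi))⁻¹ ^ n * τ ^ ((n : ℝ) / 2) := by
  rw [Real.sqrt_mul (by positivity), mul_inv, mul_pow, Real.sqrt_inv, inv_inv,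
    Real.sqrt_eq_rpow τ, ← Real.rpow_natCast (τ ^ (1 / 2 : ℝ)), ← Real.rpow_mul hτ,
    one_div_mul_eq_div]

lemma exists_precisionIntegral_eq (n : ℕ) {ν : ℝ} (hν : 0 < ν) :
    ∃ K : ℝ, 0 < K ∧ ∀ R : ℝ, 0 ≤ R →
      precisionIntegral n ν R = ENNReal.ofReal (K * (1 + R) ^ (-((n + ν) / 2))) := by
  have hA : 0 < ν / 2 + (n : ℝ) / 2 := by positivity
  have hexponent : -((n + ν) / 2) = -(ν / 2 + (n : ℝ) / 2) := by ring
  refine ⟨(√(2 * Real.pi))⁻¹ ^ n * ((1 / 2) ^ (ν / 2) / Real.Gamma (ν / 2) *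
    Real.Gamma (ν / 2 + n / 2) * (1 / 2) ^ (-(ν / 2 + (n : ℝ) / 2))), ?_, fun R hR => ?_⟩
  · have hΓ : 0 < Real.Gamma (ν / 2) := Real.Gamma_pos_of_pos (half_pos hν)
    have hΓn : 0 < Real.Gamma (ν / 2 + n / 2) := Real.Gamma_pos_of_pos hA
    positivity
  · have hcongr : precisionIntegral n ν R = ∫⁻ τ, ENNReal.ofReal ((√(2 * Real.pi))⁻¹ ^ n) *
        ENNReal.ofReal (τ ^ ((n : ℝ) / 2) * Real.exp (-(R / 2 * τ)))
          ∂(gammaMeasure (ν / 2) (1 / 2)) := by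
      refine lintegral_congr_ae ?_
      filter_upwards [ae_gammaMeasure_pos (ν / 2) (1 / 2)] with τ hτ
      rw [← ENNReal.ofReal_mul (by positivity), inv_sqrt_mul_inv_pow hτ.le, mul_assoc]
      congr 4
      ring
    have hbase : 1 / 2 + R / 2 = 1 / 2 * (1 + R) := by ring
    rw [hcongr, lintegral_const_mul _ (by fun_prop),
      lintegral_rpow_mul_exp_gammaMeasure (half_pos hν) one_half_pos hA (by positivity),
      ← ENNReal.ofReal_mul (by positivity), hbase,
      Real.mul_rpow one_half_pos.le (by positivity), hexponent]
    congr 1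
    ring

lemma precisionIntegral_ne_top (n : ℕ) {ν R : ℝ} (hν : 0 < ν) (hR : 0 ≤ R) :
    precisionIntegral n ν R ≠ ⊤ := by
  obtain ⟨K, -, hK⟩ := exists_precisionIntegral_eq n hν
  exact hK R hR ▸ ENNReal.ofReal_ne_top

lemma precisionIntegral_ne_zero (n : ℕ) {ν R : ℝ} (hν : 0 < ν) (hR : 0 ≤ R) :
    precisionIntegral n ν R ≠ 0 := by
  obtain ⟨K, hK0, hK⟩ := exists_precisionIntegral_eq n hν
  rw [hK R hR]
  exact (ENNReal.ofReal_pos.mpr (by positivity)).ne'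

lemma precisionIntegral_div (n : ℕ) {ν R S : ℝ} (hν : 0 < ν) (hR : 0 ≤ R) (hS : 0 ≤ S) :
    precisionIntegral n ν R / precisionIntegral n ν S =
      ENNReal.ofReal (((1 + S) / (1 + R)) ^ ((n + ν) / 2)) := by
  obtain ⟨K, hK0, hK⟩ := exists_precisionIntegral_eq n hν
  have hR1 : 0 < 1 + R := by positivity
  have hS1 : 0 < 1 + S := by positivity
  rw [hK R hR, hK S hS, ← ENNReal.ofReal_div_of_pos (by positivity),
    mul_div_mul_left _ _ hK0.ne', Real.rpow_neg hR1.le, Real.rpow_neg hS1.le, inv_div_inv,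
    Real.div_rpow hS1.le hR1.le]

end PrecisionIntegral

section Marginal

variable {n p : ℕ}

lemma likelihood_eq (X : Matrix (Fin n) (Fin p) ℝ) (β : Fin p → ℝ) {τ : ℝ} (hτ : 0 < τ)
    (y : Fin n → ℝ) :
    likelihood X β τ⁻¹ y = ENNReal.ofReal ((√(2 * Real.pi * τ⁻¹))⁻¹ ^ n *
      Real.exp (-τ * ((y - X *ᵥ β) ⬝ᵥ (y - X *ᵥ β)) / 2)) := by
  have hvar : ((τ⁻¹.toNNReal : ℝ≥0) : ℝ) = τ⁻¹ := Real.coe_toNNReal _ (by positivity)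
  simp only [likelihood, gaussianPDF, gaussianPDFReal, hvar]
  rw [← ENNReal.ofReal_prod_of_nonneg fun i _ => by positivity, Finset.prod_mul_distrib,
    Finset.prod_const, Finset.card_univ, Fintype.card_fin, ← Real.exp_sum, dotProduct,
    Finset.mul_sum, Finset.sum_div]
  congr 3
  refine Finset.sum_congr rfl fun i _ => ?_
  rw [Pi.sub_apply]
  field_simp

instance isProbabilityMeasure_coefPrior_component (c : Fin p → ℝ) (γ : Finset (Fin p)) (v : ℝ)
    (j : Fin p) : IsProbabilityMeasure
      (if j ∈ γ then gaussianReal 0 (c j * v).toNNReal else Measure.dirac (0 : ℝ)) := by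
  split_ifs <;> infer_instance

instance isProbabilityMeasure_coefPrior (c : Fin p → ℝ) (γ : Finset (Fin p)) (v : ℝ) :
    IsProbabilityMeasure (coefPrior c γ v) := by
  unfold coefPrior
  infer_instance

lemma ae_coefPrior_eq_zero (c : Fin p → ℝ) (γ : Finset (Fin p)) (v : ℝ) :
    ∀ᵐ β ∂(coefPrior c γ v), ∀ j ∉ γ, β j = 0 := by
  refine ae_all_iff.mpr fun j => ?_
  by_cases hj : j ∈ γ
  · exact Eventually.of_forall fun _ h => absurd hj h
  · have hdirac : ∀ᵐ t ∂(if j ∈ γ then gaussianReal 0 (c j * v).toNNReal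
        else Measure.dirac (0 : ℝ)), t = 0 := by
      rw [if_neg hj, ae_dirac_eq]
      exact rfl
    filter_upwards [Measure.tendsto_eval_ae_ae.eventually hdirac] with β hβ _
    exact hβ

lemma lintegral_coefPrior_exp_le {c : Fin p → ℝ} {a r τ : ℝ} (ha : 0 < a) (hc : ∀ j, a ≤ c j)
    (hr : 0 < r) (hτ : 0 < τ) (b : Fin p → ℝ) (γ : Finset (Fin p)) :
    ∫⁻ β, ENNReal.ofReal (Real.exp (-τ * (r * ∑ j ∈ γ, (β j - b j) ^ 2) / 2))
        ∂(coefPrior c γ τ⁻¹) ≤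
      ENNReal.ofReal ((√(r * a))⁻¹ ^ γ.card) := by
  have hsum : ∀ β : Fin p → ℝ, -τ * (r * ∑ j ∈ γ, (β j - b j) ^ 2) / 2 =
      ∑ j ∈ γ, -(τ * r) * (β j - b j) ^ 2 / 2 := fun β => by
    rw [← Finset.sum_div, ← Finset.mul_sum, ← mul_assoc, neg_mul]
  simp only [hsum, ofReal_exp_sum]
  rw [coefPrior, lintegral_finsetProd_pi (f := fun j t =>
    ENNReal.ofReal (Real.exp (-(τ * r) * (t - b j) ^ 2 / 2))) _ (fun j => by fun_prop),
    ENNReal.ofReal_pow (by positivity)]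
  refine Finset.prod_le_pow_card _ _ _ fun j hj => ?_
  have hcτ : 0 < c j * τ⁻¹ := mul_pos (ha.trans_le (hc j)) (inv_pos.mpr hτ)
  have hscale : τ * r * (c j * τ⁻¹) = r * c j := by field_simp
  rw [if_pos hj]
  refine (lintegral_exp_sq_sub_gaussianReal_le (mul_pos hτ hr)
    (Real.toNNReal_pos.mpr hcτ).ne' (b j)).trans (ENNReal.ofReal_le_ofReal ?_)
  rw [Real.coe_toNNReal _ hcτ.le, hscale]
  gcongr
  exact hc j

lemma marginal_empty (ν : ℝ) (c : Fin p → ℝ) (X : Matrix (Fin n) (Fin p) ℝ) (y : Fin n → ℝ) :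
    marginal ν c X y ∅ = precisionIntegral n ν (y ⬝ᵥ y) := by
  refine lintegral_congr_ae ?_
  filter_upwards [ae_gammaMeasure_pos (ν / 2) (1 / 2)] with τ hτ
  have hconst : ∀ᵐ β ∂(coefPrior c ∅ τ⁻¹), likelihood X β τ⁻¹ y =
      ENNReal.ofReal ((√(2 * Real.pi * τ⁻¹))⁻¹ ^ n * Real.exp (-τ * (y ⬝ᵥ y) / 2)) := by
    filter_upwards [ae_coefPrior_eq_zero c ∅ τ⁻¹] with β hβ
    have hβ0 : β = 0 := funext fun j => hβ j (Finset.notMem_empty j)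
    rw [likelihood_eq X β hτ, hβ0, mulVec_zero, sub_zero]
  rw [lintegral_congr_ae hconst, lintegral_const, measure_univ, mul_one]

lemma marginal_le (ν : ℝ) {c : Fin p → ℝ} {X : Matrix (Fin n) (Fin p) ℝ} {a r : ℝ} (ha : 0 < a)
    (hc : ∀ j, a ≤ c j) (hr : 0 < r) (h : GramBound r X) (y : Fin n → ℝ) (γ : Finset (Fin p)) :
    marginal ν c X y γ ≤
      ENNReal.ofReal ((√(r * a))⁻¹ ^ γ.card) * precisionIntegral n ν (residualSS X y γ) := by
  obtain ⟨b, hb⟩ := exists_residualSS_add_le_normSq hr h y γ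
  rw [precisionIntegral, ← lintegral_const_mul _ (by fun_prop)]
  refine lintegral_mono_ae ?_
  filter_upwards [ae_gammaMeasure_pos (ν / 2) (1 / 2)] with τ hτ
  set M : ℝ≥0∞ := ENNReal.ofReal ((√(2 * Real.pi * τ⁻¹))⁻¹ ^ n *
    Real.exp (-τ * residualSS X y γ / 2))
  calc ∫⁻ β, likelihood X β τ⁻¹ y ∂(coefPrior c γ τ⁻¹)
      ≤ ∫⁻ β, M * ENNReal.ofReal (Real.exp (-τ * (r * ∑ j ∈ γ, (β j - b j) ^ 2) / 2))
          ∂(coefPrior c γ τ⁻¹) := by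
        refine lintegral_mono_ae ?_
        filter_upwards [ae_coefPrior_eq_zero c γ τ⁻¹] with β hβ
        rw [likelihood_eq X β hτ, ← ENNReal.ofReal_mul (by positivity), mul_assoc (_ ^ n),
          ← Real.exp_add]
        gcongr
        linarith [mul_le_mul_of_nonneg_left (hb β hβ) hτ.le]
    _ ≤ ENNReal.ofReal ((√(r * a))⁻¹ ^ γ.card) * M := by
        rw [lintegral_const_mul _ (by fun_prop), mul_comm]
        gcongr
        exact lintegral_coefPrior_exp_le ha hc hr hτ b γ

lemma marginal_ne_top {ν : ℝ} (hν : 0 < ν) {c : Fin p → ℝ} {X : Matrix (Fin n) (Fin p) ℝ}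
    {a r : ℝ} (ha : 0 < a) (hc : ∀ j, a ≤ c j) (hr : 0 < r) (h : GramBound r X)
    (y : Fin n → ℝ) (γ : Finset (Fin p)) : marginal ν c X y γ ≠ ⊤ :=
  ne_top_of_le_ne_top (ENNReal.mul_ne_top ENNReal.ofReal_ne_top (precisionIntegral_ne_top n hν
    (residualSS_nonneg ((h.cols γ).isUnit_det hr) y))) (marginal_le ν ha hc hr h y γ)

lemma marginal_div_marginal_empty_le {ν : ℝ} (hν : 0 < ν) {c : Fin p → ℝ}
    {X : Matrix (Fin n) (Fin p) ℝ} {a r : ℝ} (ha : 0 < a) (hc : ∀ j, a ≤ c j) (hr : 0 < r)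
    (h : GramBound r X) (y : Fin n → ℝ) (γ : Finset (Fin p)) :
    marginal ν c X y γ / marginal ν c X y ∅ ≤ ENNReal.ofReal ((√(r * a))⁻¹ ^ γ.card) *
      ENNReal.ofReal (((1 + y ⬝ᵥ y) / (1 + residualSS X y γ)) ^ ((n + ν) / 2)) := by
  rw [marginal_empty, ← precisionIntegral_div n hν
    (residualSS_nonneg ((h.cols γ).isUnit_det hr) y) (dotProduct_self_nonneg y), ← mul_div_assoc]
  exact ENNReal.div_le_div_right (marginal_le ν ha hc hr h y γ) _

end Marginal

section Posterior

lemma pmf_apply_ne_zero_of_div_le {α : Type*} {π : PMF α} {a₀ : α} {C : ℝ≥0∞} (hC : C ≠ ⊤)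
    (h : ∀ a, π a / π a₀ ≤ C) : π a₀ ≠ 0 := by
  intro hzero
  obtain ⟨a, ha⟩ := π.support_nonempty
  have htop := h a
  rw [hzero, ENNReal.div_zero ((π.mem_support_iff a).mp ha)] at htop
  exact hC (top_le_iff.mp htop)

variable {n p : ℕ} {π : PMF (Finset (Fin p))} {ν : ℝ} {c : Fin p → ℝ}
  {X : Matrix (Fin n) (Fin p) ℝ} {y : Fin n → ℝ} {γ₀ : Finset (Fin p)}

lemma sum_prior_mul_marginal_ne_top (hfin : ∀ γ, marginal ν c X y γ ≠ ⊤) :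
    ∑ γ, π γ * marginal ν c X y γ ≠ ⊤ :=
  ENNReal.sum_ne_top.mpr fun γ _ => ENNReal.mul_ne_top (π.apply_ne_top γ) (hfin γ)

lemma sum_prior_mul_marginal_ne_zero (hπ : π γ₀ ≠ 0) (hpos : marginal ν c X y γ₀ ≠ 0) :
    ∑ γ, π γ * marginal ν c X y γ ≠ 0 := fun hzero =>
  mul_ne_zero hπ hpos (Finset.sum_eq_zero_iff.mp hzero γ₀ (Finset.mem_univ _))

lemma posterior_div_posterior (hfin : ∀ γ, marginal ν c X y γ ≠ ⊤) (hπ : π γ₀ ≠ 0)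
    (hpos : marginal ν c X y γ₀ ≠ 0) (γ : Finset (Fin p)) :
    posterior π ν c X y γ / posterior π ν c X y γ₀ =
      π γ / π γ₀ * (marginal ν c X y γ / marginal ν c X y γ₀) := by
  have hevidence0 := sum_prior_mul_marginal_ne_zero hπ hpos
  have hevidence := sum_prior_mul_marginal_ne_top (π := π) hfin
  simp only [posterior, div_eq_mul_inv]
  rw [ENNReal.mul_inv (Or.inr (ENNReal.inv_ne_top.mpr hevidence0))
    (Or.inr (ENNReal.inv_ne_zero.mpr hevidence)), inv_inv, mul_mul_mul_comm,
    ENNReal.inv_mul_cancel hevidence0 hevidence, mul_one,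
    ENNReal.mul_inv (Or.inl hπ) (Or.inr hpos), mul_mul_mul_comm]

lemma sum_posterior (hfin : ∀ γ, marginal ν c X y γ ≠ ⊤) (hπ : π γ₀ ≠ 0)
    (hpos : marginal ν c X y γ₀ ≠ 0) : ∑ γ, posterior π ν c X y γ = 1 := by
  simp only [posterior, div_eq_mul_inv]
  rw [← Finset.sum_mul, ENNReal.mul_inv_cancel (sum_prior_mul_marginal_ne_zero hπ hpos)
    (sum_prior_mul_marginal_ne_top hfin)]

end Posterior

section OddsBound

lemma div_rpow_le_exp {s t A : ℝ} (hs : 0 ≤ s) (ht : 0 < t) (hA : 0 ≤ A) :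
    (s / t) ^ A ≤ Real.exp (A * ((s - t) / t)) := by
  have hbase : s / t ≤ Real.exp ((s - t) / t) := by
    rw [sub_div, div_self ht.ne']
    linarith [Real.add_one_le_exp (s / t - 1)]
  calc (s / t) ^ A ≤ Real.exp ((s - t) / t) ^ A := by gcongr
    _ = Real.exp (A * ((s - t) / t)) := by rw [← Real.exp_mul, mul_comm]

lemma one_add_div_one_add_rpow_le_exp {S R F L D A : ℝ} (hS : 0 ≤ S) (hSR : S - R = F)
    (hD : 0 < D) (hDR : D ≤ R) (hL : 0 ≤ L) (hFL : F ≤ L) (hA : 0 ≤ A) :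
    ((1 + S) / (1 + R)) ^ A ≤ Real.exp (A * (L / D)) := by
  refine (div_rpow_le_exp (by linarith) (by linarith) hA).trans ?_
  rw [add_sub_add_left_eq_sub, hSR]
  gcongr
  linarith

variable {n p : ℕ} {X : Matrix (Fin n) (Fin p) ℝ} {y : Fin n → ℝ} {s η : ℝ}

lemma le_residualSS (hs : 0 ≤ s) (hη : 0 ≤ η) (hplog : 2 * (1 + η) * (p * Real.log p) ≤ η * n)
    (hy : (1 - η) * (n * s) ≤ y ⬝ᵥ y) {γ : Finset (Fin p)}
    (hγ : fittedSS X y γ ≤ 2 * (1 + η) * s * γ.card * Real.log p) :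
    (1 - 2 * η) * (n * s) ≤ residualSS X y γ := by
  have hcard : (γ.card : ℝ) ≤ p := Nat.cast_le.mpr (card_finset_fin_le γ)
  have hlog : 0 ≤ Real.log p := Real.log_natCast_nonneg p
  have hfit : fittedSS X y γ ≤ η * (n * s) :=
    calc fittedSS X y γ ≤ 2 * (1 + η) * s * γ.card * Real.log p := hγ
      _ ≤ 2 * (1 + η) * s * p * Real.log p := by gcongr
      _ = s * (2 * (1 + η) * (p * Real.log p)) := by ring
      _ ≤ s * (η * n) := by gcongr
      _ = η * (n * s) := by ring
  rw [residualSS]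
  linarith

lemma normSq_div_residualSS_rpow_le {ν q : ℝ} (hn : 0 < n) (hp : 0 < p) (hs : 0 < s) (hη : 0 ≤ η)
    (hη2 : 2 * η < 1) (hν : 0 ≤ ν) (hplog : 2 * (1 + η) * (p * Real.log p) ≤ η * n)
    (hq : (1 + ν / n) * (1 + η) ≤ q * (1 - 2 * η)) (hy : (1 - η) * (n * s) ≤ y ⬝ᵥ y)
    {γ : Finset (Fin p)} (hγ : fittedSS X y γ ≤ 2 * (1 + η) * s * γ.card * Real.log p) :
    ((1 + y ⬝ᵥ y) / (1 + residualSS X y γ)) ^ ((n + ν) / 2) ≤ ((p : ℝ) ^ q) ^ γ.card := by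
  have hn' : (0 : ℝ) < n := Nat.cast_pos.mpr hn
  have hlog : 0 ≤ Real.log p := Real.log_natCast_nonneg p
  have hη' : 0 < 1 - 2 * η := by linarith
  refine (one_add_div_one_add_rpow_le_exp (dotProduct_self_nonneg y) (sub_sub_cancel _ _)
    (mul_pos hη' (mul_pos hn' hs)) (le_residualSS hs.le hη hplog hy hγ) (by positivity) hγ
    (by positivity)).trans ?_
  rw [Real.rpow_def_of_pos (Nat.cast_pos.mpr hp), ← Real.exp_nat_mul, Real.exp_le_exp]
  calc (n + ν) / 2 * (2 * (1 + η) * s * γ.card * Real.log p / ((1 - 2 * η) * (n * s)))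
      = (1 + ν / n) * (1 + η) / (1 - 2 * η) * (γ.card * Real.log p) := by field_simp
    _ ≤ q * (γ.card * Real.log p) := by
        gcongr
        exact (div_le_iff₀ hη').mpr hq
    _ = γ.card * (Real.log p * q) := by ring

lemma geometricOdds_of_fittedSS_le {π : PMF (Finset (Fin p))} {ν a b r q : ℝ} {C : ℝ≥0}
    (hn : 0 < n) (hp : 0 < p) (hν : 0 < ν) (ha : 0 < a) (hr : 0 < r) (hs : 0 < s) (hη : 0 ≤ η)
    (hη2 : 2 * η < 1) (hπ : ∀ γ, π γ / π ∅ ≤ C)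
    (hplog : 2 * (1 + η) * (p * Real.log p) ≤ η * n)
    (hq : (1 + ν / n) * (1 + η) ≤ q * (1 - 2 * η)) (hX : GramBound r X)
    (hy : (1 - η) * (n * s) ≤ y ⬝ᵥ y)
    (hfit : ∀ γ : Finset (Fin p), fittedSS X y γ ≤ 2 * (1 + η) * s * γ.card * Real.log p) :
    GeometricOdds π ν a b X y C ((p : ℝ) ^ q * (√(r * a))⁻¹) := by
  intro c hc
  have hca : ∀ j, a ≤ c j := fun j => (hc j).1
  have hfin := marginal_ne_top hν ha hca hr hX y
  have hπ0 : π ∅ ≠ 0 := pmf_apply_ne_zero_of_div_le ENNReal.coe_ne_top hπ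
  have hpos : marginal ν c X y ∅ ≠ 0 := by
    rw [marginal_empty]
    exact precisionIntegral_ne_zero n hν (dotProduct_self_nonneg y)
  refine ⟨sum_posterior hfin hπ0 hpos, fun γ => ?_⟩
  rw [posterior_div_posterior hfin hπ0 hpos]
  refine mul_le_mul' (hπ γ) ((marginal_div_marginal_empty_le hν ha hca hr hX y γ).trans ?_)
  rw [← ENNReal.ofReal_mul (by positivity), mul_pow, mul_comm]
  gcongr
  exact normSq_div_residualSS_rpow_le hn hp hs hη hη2 hν.le hplog hq hy (hfit γ)

end OddsBound

section ExtendedDistance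

lemma edist_le_of_le_add {u v t : ℝ≥0∞} (huv : u ≤ v + t) (hvu : v ≤ u + t) : edist u v ≤ t := by
  rcases eq_or_ne t ⊤ with rfl | ht
  · exact le_top
  rcases eq_or_ne u ⊤ with rfl | hu
  · have hv : v = ⊤ := (ENNReal.add_eq_top.mp (top_le_iff.mp huv)).resolve_right ht
    rw [hv, WeakPseudoEMetricSpace.edist_self]
    exact zero_le
  have hv : v ≠ ⊤ := ne_top_of_le_ne_top (ENNReal.add_ne_top.mpr ⟨hu, ht⟩) hvu
  lift u to ℝ≥0 using hu
  lift v to ℝ≥0 using hv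
  have hedist : edist (u : ℝ≥0∞) v = max ((u : ℝ≥0∞) - v) (v - u) := by
    change edist u v = _
    rw [edist_nndist, NNReal.nndist_eq, ENNReal.coe_max, ENNReal.coe_sub, ENNReal.coe_sub]
  rw [hedist]
  exact max_le (tsub_le_iff_left.mpr huv) (tsub_le_iff_left.mpr hvu)

lemma edist_zero_le_of_le {u t : ℝ≥0∞} (h : u ≤ t) : edist u 0 ≤ t :=
  edist_le_of_le_add (by rwa [zero_add]) zero_le

end ExtendedDistance

section SumOverModels

variable {p : ℕ}

lemma sum_erase_empty_pow_card (x : ℝ) :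
    ∑ γ ∈ (Finset.univ : Finset (Finset (Fin p))).erase ∅, x ^ γ.card = (1 + x) ^ p - 1 := by
  have hbinom : ∑ γ : Finset (Fin p), x ^ γ.card = (1 + x) ^ p := by
    simpa only [one_pow, mul_one, Fintype.card_fin, add_comm] using
      Fintype.sum_pow_mul_eq_add_pow (Fin p) x 1
  rw [← hbinom, ← Finset.add_sum_erase _ _ (Finset.mem_univ (∅ : Finset (Fin p))),
    Finset.card_empty, pow_zero, add_sub_cancel_left]

lemma sum_erase_empty_pow_card_le {x : ℝ} (hx : 0 ≤ x) :
    ∑ γ ∈ (Finset.univ : Finset (Finset (Fin p))).erase ∅, x ^ γ.card ≤ Real.exp (p * x) - 1 := by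
  rw [sum_erase_empty_pow_card, Real.exp_nat_mul]
  gcongr
  linarith [Real.add_one_le_exp x]

variable {n : ℕ} {π : PMF (Finset (Fin p))} {ν a b : ℝ} {X : Matrix (Fin n) (Fin p) ℝ}
  {y : Fin n → ℝ} {C : ℝ≥0} {x : ℝ}

lemma posterior_le_one {c : Fin p → ℝ} (h : ∑ γ, posterior π ν c X y γ = 1)
    (γ : Finset (Fin p)) : posterior π ν c X y γ ≤ 1 :=
  h ▸ Finset.single_le_sum (fun _ _ => zero_le) (Finset.mem_univ γ)

lemma GeometricOdds.supOdds_le (h : GeometricOdds π ν a b X y C x) (hx0 : 0 ≤ x) (hx1 : x ≤ 1) :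
    supOdds π ν a b ∅ X y ≤ C * ENNReal.ofReal x := by
  refine iSup₂_le fun c hc => iSup₂_le fun γ hγ => ((h c hc).2 γ).trans ?_
  gcongr
  exact pow_le_of_le_one hx0 hx1 (Finset.card_ne_zero.mpr (Finset.nonempty_iff_ne_empty.mpr hγ))

lemma GeometricOdds.posterior_le (h : GeometricOdds π ν a b X y C x) {c : Fin p → ℝ}
    (hc : c ∈ hyperBox p a b) (γ : Finset (Fin p)) :
    posterior π ν c X y γ ≤ C * ENNReal.ofReal (x ^ γ.card) :=
  calc posterior π ν c X y γ = posterior π ν c X y γ / 1 := (div_one _).symm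
    _ ≤ posterior π ν c X y γ / posterior π ν c X y ∅ :=
        ENNReal.div_le_div_left (posterior_le_one (h c hc).1 ∅) _
    _ ≤ C * ENNReal.ofReal (x ^ γ.card) := (h c hc).2 γ

lemma GeometricOdds.supWrong_le (h : GeometricOdds π ν a b X y C x) (hx0 : 0 ≤ x) :
    supWrong π ν a b ∅ X y ≤ C * ENNReal.ofReal (Real.exp (p * x) - 1) := by
  refine iSup₂_le fun c hc => ?_
  calc ∑ γ ∈ Finset.univ.erase ∅, posterior π ν c X y γ
      ≤ ∑ γ ∈ (Finset.univ : Finset (Finset (Fin p))).erase ∅, C * ENNReal.ofReal (x ^ γ.card) :=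
        Finset.sum_le_sum fun γ _ => h.posterior_le hc γ
    _ ≤ C * ENNReal.ofReal (Real.exp (p * x) - 1) := by
        rw [← Finset.mul_sum, ← ENNReal.ofReal_sum_of_nonneg fun γ _ => by positivity]
        gcongr
        exact sum_erase_empty_pow_card_le hx0

lemma GeometricOdds.one_le_infTrue_add_supWrong (h : GeometricOdds π ν a b X y C x) :
    1 ≤ infTrue π ν a b ∅ X y + supWrong π ν a b ∅ X y := by
  rw [← tsub_le_iff_right]
  refine le_iInf₂ fun c hc => ?_
  rw [tsub_le_iff_right, ← (h c hc).1, ← Finset.add_sum_erase _ _ (Finset.mem_univ ∅)]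
  gcongr
  exact le_iSup₂ (f := fun c (_ : c ∈ hyperBox p a b) =>
    ∑ γ ∈ Finset.univ.erase ∅, posterior π ν c X y γ) c hc

lemma GeometricOdds.infTrue_le_one (h : GeometricOdds π ν a b X y C x) (hab : a ≤ b) :
    infTrue π ν a b ∅ X y ≤ 1 := by
  have hmem : (fun _ => a) ∈ hyperBox p a b := fun _ => ⟨le_rfl, hab⟩
  exact (iInf₂_le _ hmem).trans (posterior_le_one (h _ hmem).1 ∅)

lemma GeometricOdds.edist_infTrue_one_le (h : GeometricOdds π ν a b X y C x) (hab : a ≤ b) :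
    edist (infTrue π ν a b ∅ X y) 1 ≤ supWrong π ν a b ∅ X y :=
  edist_le_of_le_add ((h.infTrue_le_one hab).trans le_self_add) h.one_le_infTrue_add_supWrong

end SumOverModels

section Deviations

variable {n p : ℕ}

lemma measurable_projMatrix_apply (γ : Finset (Fin p)) (i j : Fin n) :
    Measurable fun x : Fin n → Fin p → ℝ => projMatrix (Matrix.of x) γ i j := by
  have hcols : Continuous fun x : Fin n → Fin p → ℝ => cols (Matrix.of x) γ :=
    Continuous.matrix_submatrix continuous_id _ _
  have hcol : ∀ k l, Measurable fun x : Fin n → Fin p → ℝ => cols (Matrix.of x) γ k l :=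
    fun k l => (hcols.matrix_elem k l).measurable
  have hgram : Continuous fun x : Fin n → Fin p → ℝ =>
      (cols (Matrix.of x) γ)ᵀ * cols (Matrix.of x) γ := hcols.matrix_transpose.matrix_mul hcols
  -- Matrix inversion is discontinuous at singular matrices, but Cramer's rule makes it measurable.
  have hinv : ∀ k l, Measurable fun x : Fin n → Fin p → ℝ =>
      ((cols (Matrix.of x) γ)ᵀ * cols (Matrix.of x) γ)⁻¹ k l := fun k l => by
    simp only [Matrix.inv_def, Ring.inverse_eq_inv', Matrix.smul_apply, smul_eq_mul]
    exact hgram.matrix_det.measurable.inv.mul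
      (hgram.matrix_adjugate.matrix_elem k l).measurable
  simp only [projMatrix, Matrix.mul_apply]
  exact Finset.measurable_fun_sum _ fun k _ => (Finset.measurable_fun_sum _ fun l _ =>
    (hcol i l).mul (hinv l k)).mul (hcol j k)

lemma measurable_fittedSS (γ : Finset (Fin p)) :
    Measurable fun z : (Fin n → Fin p → ℝ) × (Fin n → ℝ) =>
      fittedSS (Matrix.of z.1) z.2 γ := by
  simp only [fittedSS, dotProduct, mulVec]
  exact Finset.measurable_fun_sum _ fun i _ => ((measurable_pi_apply i).comp measurable_snd).mul
    (Finset.measurable_fun_sum _ fun j _ =>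
      ((measurable_projMatrix_apply γ i j).comp measurable_fst).mul
        ((measurable_pi_apply j).comp measurable_snd))

variable {Ω : Type*} [MeasurableSpace Ω] {P : Measure Ω}

lemma measure_le_of_lintegral_exp_le {f : Ω → ℝ} (hf : AEMeasurable f P) {M : ℝ}
    (hM : ∫⁻ ω, ENNReal.ofReal (Real.exp (f ω)) ∂P ≤ ENNReal.ofReal M) (t : ℝ) :
    P {ω | t ≤ f ω} ≤ ENNReal.ofReal (M * Real.exp (-t)) := by
  have hpos : 0 < Real.exp t := Real.exp_pos t
  calc P {ω | t ≤ f ω}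
      ≤ P {ω | ENNReal.ofReal (Real.exp t) ≤ ENNReal.ofReal (Real.exp (f ω))} :=
        measure_mono fun ω hω => ENNReal.ofReal_le_ofReal (Real.exp_le_exp.mpr hω)
    _ ≤ (∫⁻ ω, ENNReal.ofReal (Real.exp (f ω)) ∂P) / ENNReal.ofReal (Real.exp t) :=
        meas_ge_le_lintegral_div (by fun_prop) (ENNReal.ofReal_pos.mpr hpos).ne'
          ENNReal.ofReal_ne_top
    _ ≤ ENNReal.ofReal M / ENNReal.ofReal (Real.exp t) := ENNReal.div_le_div_right hM _
    _ = ENNReal.ofReal (M * Real.exp (-t)) := by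
        rw [← ENNReal.ofReal_div_of_pos hpos, Real.exp_neg, div_eq_mul_inv]

lemma measure_normSq_lt_le {e : Ω → Fin n → ℝ} {v : ℝ≥0} (hv : v ≠ 0)
    (he : HasLaw e (Measure.pi fun _ => gaussianReal 0 v) P) {η : ℝ} (hη : 0 < η) :
    P {ω | e ω ⬝ᵥ e ω < (1 - η) * (n * v)} ≤
      ENNReal.ofReal (((√(1 + η))⁻¹ * Real.exp (η * (1 - η) / 2)) ^ n) := by
  have hv' : (0 : ℝ) < v := NNReal.coe_pos.mpr (pos_iff_ne_zero.mpr hv)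
  have hmeas : Measurable fun x : Fin n → ℝ => x ⬝ᵥ x :=
    (Continuous.dotProduct continuous_id continuous_id).measurable
  have hmoment : ∫⁻ ω, ENNReal.ofReal (Real.exp (-η * (e ω ⬝ᵥ e ω) / (2 * v))) ∂P ≤
      ENNReal.ofReal ((√(1 + η))⁻¹ ^ n) := by
    have hgauss := lintegral_exp_dotProduct_self (ι := Fin n) (by linarith : -1 < η) hv
    rw [Fintype.card_fin, ← he.map_eq, lintegral_map' (by fun_prop) he.aemeasurable] at hgauss
    exact hgauss.le
  have hchernoff := measure_le_of_lintegral_exp_le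
    (((hmeas.comp_aemeasurable he.aemeasurable).const_mul (-η)).div_const (2 * (v : ℝ))) hmoment
    (-(n * (η * (1 - η) / 2)))
  rw [neg_neg, Real.exp_nat_mul, ← mul_pow] at hchernoff
  refine (measure_mono fun ω (hω : e ω ⬝ᵥ e ω < _) => ?_).trans hchernoff
  simp only [Set.mem_ofPred_eq, Function.comp]
  rw [le_div_iff₀ (by positivity)]
  linarith [mul_lt_mul_of_pos_left hω hη]

variable [IsProbabilityMeasure P] {X : Ω → Fin n → Fin p → ℝ} {e : Ω → Fin n → ℝ} {v : ℝ≥0}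

lemma lintegral_exp_fittedSS_le (hv : v ≠ 0) (hX : AEMeasurable X P)
    (he : HasLaw e (Measure.pi fun _ => gaussianReal 0 v) P) (hXe : IndepFun X e P)
    (γ : Finset (Fin p)) {s : ℝ} (hs0 : 0 ≤ s) (hs1 : s < 1) :
    ∫⁻ ω, ENNReal.ofReal (Real.exp (s * fittedSS (Matrix.of (X ω)) (e ω) γ / (2 * v))) ∂P ≤
      ENNReal.ofReal ((√(1 - s))⁻¹ ^ γ.card) := by
  have hmeas : Measurable fun z : (Fin n → Fin p → ℝ) × (Fin n → ℝ) => ENNReal.ofReal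
      (Real.exp (s * fittedSS (Matrix.of z.1) z.2 γ / (2 * v))) :=
    (((measurable_fittedSS γ).const_mul s).div_const _).exp.ennreal_ofReal
  have hprob := Measure.isProbabilityMeasure_map (μ := P) hX
  calc ∫⁻ ω, ENNReal.ofReal (Real.exp (s * fittedSS (Matrix.of (X ω)) (e ω) γ / (2 * v))) ∂P
      = ∫⁻ z, ENNReal.ofReal (Real.exp (s * fittedSS (Matrix.of z.1) z.2 γ / (2 * v)))
          ∂(P.map fun ω => (X ω, e ω)) :=
        (lintegral_map' hmeas.aemeasurable (hX.prodMk he.aemeasurable)).symm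
    _ ≤ ∫⁻ _, ENNReal.ofReal ((√(1 - s))⁻¹ ^ γ.card) ∂(P.map X) := by
        rw [(indepFun_iff_map_prod_eq_prod_map_map hX he.aemeasurable).mp hXe, he.map_eq,
          lintegral_prod _ hmeas.aemeasurable]
        refine lintegral_mono fun x => ?_
        simpa only [fittedSS, projMatrix, Fintype.card_coe] using
          lintegral_exp_projection_le (cols (Matrix.of x) γ) hv hs0 hs1
    _ = ENNReal.ofReal ((√(1 - s))⁻¹ ^ γ.card) := by
        rw [lintegral_const, measure_univ, mul_one]

lemma measure_fittedSS_gt_le (hv : v ≠ 0) (hX : AEMeasurable X P)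
    (he : HasLaw e (Measure.pi fun _ => gaussianReal 0 v) P) (hXe : IndepFun X e P)
    (γ : Finset (Fin p)) (hp : 0 < p) {s : ℝ} (hs0 : 0 < s) (hs1 : s < 1) (η : ℝ) :
    P {ω | 2 * (1 + η) * v * γ.card * Real.log p < fittedSS (Matrix.of (X ω)) (e ω) γ} ≤
      ENNReal.ofReal (((√(1 - s))⁻¹ * (p : ℝ) ^ (-(s * (1 + η)))) ^ γ.card) := by
  have hv' : (0 : ℝ) < v := NNReal.coe_pos.mpr (pos_iff_ne_zero.mpr hv)
  have hchernoff := measure_le_of_lintegral_exp_le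
    ((((measurable_fittedSS γ).comp_aemeasurable (hX.prodMk he.aemeasurable)).const_mul s).div_const
      (2 * (v : ℝ))) (lintegral_exp_fittedSS_le hv hX he hXe γ hs0.le hs1)
    (s * (1 + η) * γ.card * Real.log p)
  have hpow : Real.exp (-(s * (1 + η) * γ.card * Real.log p)) =
      ((p : ℝ) ^ (-(s * (1 + η)))) ^ γ.card := by
    rw [Real.rpow_def_of_pos (Nat.cast_pos.mpr hp), ← Real.exp_nat_mul]
    congr 1
    ring
  rw [hpow, ← mul_pow] at hchernoff
  refine (measure_mono fun ω (hω : _ < fittedSS (Matrix.of (X ω)) (e ω) γ) => ?_).trans hchernoff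
  simp only [Set.mem_ofPred_eq, Function.comp]
  rw [le_div_iff₀ (by positivity)]
  linarith [mul_lt_mul_of_pos_left hω hs0]

lemma measure_exists_fittedSS_gt_le (hv : v ≠ 0) (hX : AEMeasurable X P)
    (he : HasLaw e (Measure.pi fun _ => gaussianReal 0 v) P) (hXe : IndepFun X e P)
    (hp : 0 < p) {s : ℝ} (hs0 : 0 < s) (hs1 : s < 1) (η : ℝ) :
    P {ω | ∃ γ : Finset (Fin p),
        2 * (1 + η) * v * γ.card * Real.log p < fittedSS (Matrix.of (X ω)) (e ω) γ} ≤
      ENNReal.ofReal (Real.exp ((√(1 - s))⁻¹ * (p : ℝ) ^ (1 - s * (1 + η))) - 1) := by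
  set x : ℝ := (√(1 - s))⁻¹ * (p : ℝ) ^ (-(s * (1 + η))) with hx
  have hx0 : 0 ≤ x := by positivity
  have hpx : (√(1 - s))⁻¹ * (p : ℝ) ^ (1 - s * (1 + η)) = p * x := by
    rw [hx, sub_eq_add_neg 1 (s * (1 + η)), Real.rpow_add (Nat.cast_pos.mpr hp), Real.rpow_one]
    ring
  calc P {ω | ∃ γ : Finset (Fin p),
        2 * (1 + η) * v * γ.card * Real.log p < fittedSS (Matrix.of (X ω)) (e ω) γ}
      ≤ P (⋃ γ ∈ (Finset.univ : Finset (Finset (Fin p))).erase ∅,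
          {ω | 2 * (1 + η) * v * γ.card * Real.log p < fittedSS (Matrix.of (X ω)) (e ω) γ}) := by
        refine measure_mono fun ω ⟨γ, hγ⟩ => ?_
        have hne : γ ≠ ∅ := by
          rintro rfl
          simp only [fittedSS_empty, Finset.card_empty, Nat.cast_zero, mul_zero, zero_mul,
            lt_self_iff_false] at hγ
        exact Set.mem_biUnion (Finset.mem_erase.mpr ⟨hne, Finset.mem_univ γ⟩) hγ
    _ ≤ ∑ γ ∈ (Finset.univ : Finset (Finset (Fin p))).erase ∅,
          P {ω | 2 * (1 + η) * v * γ.card * Real.log p < fittedSS (Matrix.of (X ω)) (e ω) γ} :=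
        measure_biUnion_finset_le _ _
    _ ≤ ∑ γ ∈ (Finset.univ : Finset (Finset (Fin p))).erase ∅, ENNReal.ofReal (x ^ γ.card) :=
        Finset.sum_le_sum fun γ _ => measure_fittedSS_gt_le hv hX he hXe γ hp hs0 hs1 η
    _ ≤ ENNReal.ofReal (Real.exp ((√(1 - s))⁻¹ * (p : ℝ) ^ (1 - s * (1 + η))) - 1) := by
        rw [← ENNReal.ofReal_sum_of_nonneg fun γ _ => by positivity, hpx]
        exact ENNReal.ofReal_le_ofReal (sum_erase_empty_pow_card_le hx0)

end Deviations

section WithHighProbability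

variable {ι Ω E : Type*} [MeasurableSpace Ω] {P : Measure Ω} {l : Filter ι}

/-- The property `A i` fails with probability tending to zero along `l`. The events need not be
measurable, so this refers to the outer measure of the exceptional sets. -/
def WithHighProbability (P : Measure Ω) (l : Filter ι) (A : ι → Ω → Prop) : Prop :=
  Tendsto (fun i => P {ω | ¬ A i ω}) l (𝓝 0)

lemma WithHighProbability.of_eventually_measure_le {A : ι → Ω → Prop} {u : ι → ℝ≥0∞}
    (hu : Tendsto u l (𝓝 0)) (hA : ∀ᶠ i in l, P {ω | ¬ A i ω} ≤ u i) :
    WithHighProbability P l A :=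
  tendsto_of_tendsto_of_tendsto_of_le_of_le' tendsto_const_nhds hu
    (Eventually.of_forall fun _ => zero_le) hA

lemma WithHighProbability.of_eventually_ae {A : ι → Ω → Prop}
    (hA : ∀ᶠ i in l, ∀ᵐ ω ∂P, A i ω) : WithHighProbability P l A :=
  .of_eventually_measure_le tendsto_const_nhds (hA.mono fun _ h => (ae_iff.mp h).le)

lemma WithHighProbability.mono {A B : ι → Ω → Prop} (hA : WithHighProbability P l A)
    (hAB : ∀ᶠ i in l, ∀ ω, A i ω → B i ω) : WithHighProbability P l B :=
  .of_eventually_measure_le hA (hAB.mono fun _ h => measure_mono fun ω => mt (h ω))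

lemma WithHighProbability.and {A B : ι → Ω → Prop} (hA : WithHighProbability P l A)
    (hB : WithHighProbability P l B) : WithHighProbability P l fun i ω => A i ω ∧ B i ω := by
  have hadd := Tendsto.add hA hB
  rw [add_zero] at hadd
  refine .of_eventually_measure_le hadd (Eventually.of_forall fun i => ?_)
  refine (measure_mono fun ω hω => ?_).trans (measure_union_le _ _)
  exact not_and_or.mp hω

lemma WithHighProbability.tendstoInMeasure [EDist E] {f : ι → Ω → E} {g : Ω → E} {u : ι → ℝ≥0∞}
    (h : WithHighProbability P l fun i ω => edist (f i ω) (g ω) ≤ u i) (hu : Tendsto u l (𝓝 0)) :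
    TendstoInMeasure P f l g := by
  intro ε hε
  refine h.mono (B := fun i ω => ¬ ε ≤ edist (f i ω) (g ω)) ?_ |>.congr fun i => ?_
  · filter_upwards [hu.eventually_lt_const hε] with i hi ω hω
    exact not_le.mpr (hω.trans_lt hi)
  · simp only [not_not]

end WithHighProbability

section ErrorLimits

variable {Ω : Type*} [MeasurableSpace Ω] {P : Measure Ω} {e : ∀ n : ℕ, Ω → Fin n → ℝ} {v : ℝ≥0}

lemma exp_mul_one_sub_lt_one_add {η : ℝ} (hη : 0 < η) : Real.exp (η * (1 - η)) < 1 + η := by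
  have hpos : 0 < 1 - η * (1 - η) := by nlinarith [sq_nonneg (η - 1)]
  refine lt_of_mul_lt_mul_right ?_ hpos.le
  calc Real.exp (η * (1 - η)) * (1 - η * (1 - η))
      ≤ Real.exp (η * (1 - η)) * Real.exp (-(η * (1 - η))) := by
        gcongr
        exact Real.one_sub_le_exp_neg _
    _ = 1 := by rw [← Real.exp_add, add_neg_cancel, Real.exp_zero]
    _ < 1 + η ^ 3 := lt_add_of_pos_right 1 (pow_pos hη 3)
    _ = (1 + η) * (1 - η * (1 - η)) := by ring

lemma withHighProbability_le_normSq (hv : v ≠ 0)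
    (he : ∀ n, 1 ≤ n → HasLaw (e n) (Measure.pi fun _ => gaussianReal 0 v) P)
    {η : ℝ} (hη : 0 < η) :
    WithHighProbability P atTop fun n ω => (1 - η) * (n * v) ≤ e n ω ⬝ᵥ e n ω := by
  set ρ : ℝ := (√(1 + η))⁻¹ * Real.exp (η * (1 - η) / 2) with hρ
  have hρ1 : ρ < 1 := by
    rw [hρ, Real.exp_half, ← div_eq_inv_mul, div_lt_one (by positivity)]
    exact Real.sqrt_lt_sqrt (by positivity) (exp_mul_one_sub_lt_one_add hη)
  have hlim : Tendsto (fun n : ℕ => ENNReal.ofReal (ρ ^ n)) atTop (𝓝 0) := by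
    simpa only [ENNReal.ofReal_zero] using ENNReal.tendsto_ofReal
      (tendsto_pow_atTop_nhds_zero_of_lt_one (by positivity : 0 ≤ ρ) hρ1)
  refine .of_eventually_measure_le hlim ?_
  filter_upwards [eventually_ge_atTop 1] with n hn
  simpa only [not_le] using measure_normSq_lt_le hv (he n hn) hη

variable [IsProbabilityMeasure P] {p : ℕ → ℕ} {X : ∀ n : ℕ, Ω → Fin n → Fin (p n) → ℝ}

lemma withHighProbability_fittedSS_le (hv : v ≠ 0) (hX : ∀ n, 1 ≤ n → AEMeasurable (X n) P)
    (he : ∀ n, 1 ≤ n → HasLaw (e n) (Measure.pi fun _ => gaussianReal 0 v) P)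
    (hXe : ∀ n, 1 ≤ n → IndepFun (X n) (e n) P) (hp : Tendsto p atTop atTop)
    {η : ℝ} (hη : 0 < η) :
    WithHighProbability P atTop fun n ω => ∀ γ : Finset (Fin (p n)),
      fittedSS (Matrix.of (X n ω)) (e n ω) γ ≤ 2 * (1 + η) * v * γ.card * Real.log (p n) := by
  -- Any exponent `s < 1` with `1 < s * (1 + η)` would do.
  set s : ℝ := (1 + η / 2) / (1 + η) with hs
  have hs0 : 0 < s := by positivity
  have hs1 : s < 1 := (div_lt_one (by positivity)).mpr (by linarith)
  have hsη : 1 - s * (1 + η) = -(η / 2) := by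
    rw [hs, div_mul_cancel₀ _ (by positivity)]
    ring
  have hpow : Tendsto (fun n => (p n : ℝ) ^ (1 - s * (1 + η))) atTop (𝓝 0) := by
    rw [hsη]
    exact (tendsto_rpow_neg_atTop (half_pos hη)).comp (tendsto_natCast_atTop_atTop.comp hp)
  have hlim : Tendsto (fun n => ENNReal.ofReal
      (Real.exp ((√(1 - s))⁻¹ * (p n : ℝ) ^ (1 - s * (1 + η))) - 1)) atTop (𝓝 0) := by
    simpa only [mul_zero, Real.exp_zero, sub_self, ENNReal.ofReal_zero] using
      ENNReal.tendsto_ofReal ((hpow.const_mul (√(1 - s))⁻¹).rexp.sub_const 1)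
  refine .of_eventually_measure_le hlim ?_
  filter_upwards [eventually_ge_atTop 1, hp.eventually_ge_atTop 1] with n hn hpn
  simpa only [not_forall, not_le] using
    measure_exists_fittedSS_gt_le hv (hX n hn) (he n hn) (hXe n hn) hpn hs0 hs1 η

lemma exists_pos_one_add_lt_mul_one_sub_two_mul {q : ℝ} (hq : 1 < q) :
    ∃ η : ℝ, 0 < η ∧ 2 * η < 1 ∧ 1 + η < q * (1 - 2 * η) := by
  have hden : 0 < 2 * (1 + 2 * q) := by linarith
  refine ⟨(q - 1) / (2 * (1 + 2 * q)), div_pos (by linarith) hden, ?_, ?_⟩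
  · rw [← mul_div_assoc, div_lt_one hden]
    linarith
  · have hη : (q - 1) / (2 * (1 + 2 * q)) * (2 * (1 + 2 * q)) = q - 1 :=
      div_mul_cancel₀ _ hden.ne'
    linarith

lemma eventually_one_add_div_mul_le (ν : ℝ) {A B : ℝ} (h : A < B) :
    ∀ᶠ n : ℕ in atTop, (1 + ν / n) * A ≤ B := by
  have hlim := ((tendsto_const_div_atTop_nhds_zero_nat ν).const_add 1).mul_const A
  rw [add_zero, one_mul] at hlim
  exact hlim.eventually_le_const h

lemma withHighProbability_geometricOdds (hv : v ≠ 0)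
    (hX : ∀ n, 1 ≤ n → AEMeasurable (X n) P)
    (he : ∀ n, 1 ≤ n → HasLaw (e n) (Measure.pi fun _ => gaussianReal 0 v) P)
    (hXe : ∀ n, 1 ≤ n → IndepFun (X n) (e n) P) {ν : ℝ} (hν : 0 < ν)
    {π : ∀ n : ℕ, PMF (Finset (Fin (p n)))} {C : ℝ≥0} (hπ : ∀ n, 1 ≤ n → ∀ γ, π n γ / π n ∅ ≤ C)
    (hp : Tendsto p atTop atTop)
    (hplog : (fun n => (p n : ℝ) * Real.log (p n)) =o[atTop] fun n => (n : ℝ))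
    {a b r : ℕ → ℝ} (ha : ∀ n, 1 ≤ n → 0 < a n) (hr : ∀ n, 1 ≤ n → 0 < r n)
    (hgram : WithHighProbability P atTop fun n ω => GramBound (r n) (Matrix.of (X n ω)))
    {q : ℝ} (hq : 1 < q) :
    WithHighProbability P atTop fun n ω =>
      GeometricOdds (π n) ν (a n) (b n) (Matrix.of (X n ω)) (e n ω) C
        ((p n : ℝ) ^ q * (√(r n * a n))⁻¹) := by
  obtain ⟨η, hη, hη2, hηq⟩ := exists_pos_one_add_lt_mul_one_sub_two_mul hq
  have hplog_le : ∀ᶠ n : ℕ in atTop, 2 * (1 + η) * (p n * Real.log (p n)) ≤ η * n := by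
    filter_upwards [(hplog.const_mul_left (2 * (1 + η))).bound hη] with n hn
    rw [Real.norm_of_nonneg (Nat.cast_nonneg n)] at hn
    exact (Real.le_norm_self _).trans hn
  refine (hgram.and ((withHighProbability_le_normSq hv he hη).and
    (withHighProbability_fittedSS_le hv hX he hXe hp hη))).mono ?_
  filter_upwards [eventually_one_add_div_mul_le ν hηq, hplog_le, eventually_ge_atTop 1,
    hp.eventually_ge_atTop 1] with n hνn hpl hn hpn ω ⟨hG, hnorm, hfit⟩
  exact geometricOdds_of_fittedSS_le hn hpn hν (ha n hn) (hr n hn)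
    (NNReal.coe_pos.mpr (pos_iff_ne_zero.mpr hv)) hη.le hη2 (hπ n hn) hpl hνn hG hnorm hfit

end ErrorLimits

section PosteriorLimits

lemma tendsto_rpow_half_mul_inv_sqrt {ι : Type*} {l : Filter ι} {u N : ι → ℝ} (hu : ∀ i, 0 ≤ u i)
    {a : ℝ} (h : (fun i => u i ^ a) =o[l] N) :
    Tendsto (fun i => u i ^ (a / 2) * (√(N i))⁻¹) l (𝓝 0) := by
  have hsqrt := h.tendsto_div_nhds_zero.sqrt
  rw [Real.sqrt_zero] at hsqrt
  refine hsqrt.congr fun i => ?_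
  rw [Real.sqrt_div (Real.rpow_nonneg (hu i) a), div_eq_mul_inv, Real.sqrt_eq_rpow,
    ← Real.rpow_mul (hu i), mul_one_div]

lemma tendsto_mul_rpow_half_mul_inv_sqrt {ι : Type*} {l : Filter ι} {u N : ι → ℝ}
    (hu : ∀ i, 0 ≤ u i) {a : ℝ} (ha : 0 < a) (h : (fun i => u i ^ (a + 2)) =o[l] N) :
    Tendsto (fun i => u i * (u i ^ (a / 2) * (√(N i))⁻¹)) l (𝓝 0) := by
  refine (tendsto_rpow_half_mul_inv_sqrt hu h).congr fun i => ?_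
  rw [add_div, div_self two_ne_zero, Real.rpow_add_one' (hu i) (by positivity), mul_comm (_ ^ _),
    mul_assoc]

variable {Ω : Type*} [MeasurableSpace Ω] {P : Measure Ω} {l : Filter ℕ} {p : ℕ → ℕ}
  {π : ∀ n : ℕ, PMF (Finset (Fin (p n)))} {ν : ℝ} {a b x : ℕ → ℝ}
  {X : ∀ n : ℕ, Ω → Matrix (Fin n) (Fin (p n)) ℝ} {y : ∀ n : ℕ, Ω → Fin n → ℝ} {C : ℝ≥0}

lemma tendstoInMeasure_supOdds (hx0 : ∀ n, 0 ≤ x n) (hx : Tendsto x l (𝓝 0))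
    (h : WithHighProbability P l fun n ω =>
      GeometricOdds (π n) ν (a n) (b n) (X n ω) (y n ω) C (x n)) :
    TendstoInMeasure P (fun n ω => supOdds (π n) ν (a n) (b n) ∅ (X n ω) (y n ω)) l
      (fun _ => 0) := by
  have hlim : Tendsto (fun n => C * ENNReal.ofReal (x n)) l (𝓝 0) := by
    simpa only [ENNReal.ofReal_zero, mul_zero] using
      ENNReal.Tendsto.const_mul (ENNReal.tendsto_ofReal hx) (.inr ENNReal.coe_ne_top)
  refine (h.mono ?_).tendstoInMeasure hlim
  filter_upwards [hx.eventually_le_const one_pos] with n hx1 ω hω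
  exact edist_zero_le_of_le (hω.supOdds_le (hx0 n) hx1)

lemma tendsto_mul_ofReal_exp_sub_one (C : ℝ≥0) (hx : Tendsto (fun n => p n * x n) l (𝓝 0)) :
    Tendsto (fun n => C * ENNReal.ofReal (Real.exp (p n * x n) - 1)) l (𝓝 0) := by
  simpa only [Real.exp_zero, sub_self, ENNReal.ofReal_zero, mul_zero] using
    ENNReal.Tendsto.const_mul (ENNReal.tendsto_ofReal (hx.rexp.sub_const 1))
      (.inr ENNReal.coe_ne_top)

lemma tendstoInMeasure_supWrong (hx0 : ∀ n, 0 ≤ x n) (hx : Tendsto (fun n => p n * x n) l (𝓝 0))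
    (h : WithHighProbability P l fun n ω =>
      GeometricOdds (π n) ν (a n) (b n) (X n ω) (y n ω) C (x n)) :
    TendstoInMeasure P (fun n ω => supWrong (π n) ν (a n) (b n) ∅ (X n ω) (y n ω)) l
      (fun _ => 0) :=
  (h.mono (Eventually.of_forall fun n _ hω =>
    edist_zero_le_of_le (hω.supWrong_le (hx0 n)))).tendstoInMeasure
      (tendsto_mul_ofReal_exp_sub_one C hx)

lemma tendstoInMeasure_infTrue (hab : ∀ᶠ n in l, a n ≤ b n) (hx0 : ∀ n, 0 ≤ x n)
    (hx : Tendsto (fun n => p n * x n) l (𝓝 0))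
    (h : WithHighProbability P l fun n ω =>
      GeometricOdds (π n) ν (a n) (b n) (X n ω) (y n ω) C (x n)) :
    TendstoInMeasure P (fun n ω => infTrue (π n) ν (a n) (b n) ∅ (X n ω) (y n ω)) l
      (fun _ => 1) :=
  (h.mono (hab.mono fun n habn _ hω =>
    (hω.edist_infTrue_one_le habn).trans (hω.supWrong_le (hx0 n)))).tendstoInMeasure
      (tendsto_mul_ofReal_exp_sub_one C hx)

end PosteriorLimits

end BayesSelection

open BayesSelection in
theorem mainTheorem3_general
    {Ω : Type*} [MeasurableSpace Ω] (P : Measure Ω) [IsProbabilityMeasure P] (p : ℕ → ℕ)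
    (X : ∀ n : ℕ, Ω → (Fin n → Fin (p n) → ℝ)) (ε : ∀ n : ℕ, Ω → (Fin n → ℝ))
    (σ₀ : ℝ≥0) (hσ₀ : 0 < σ₀)
    (hX : ∀ n, 1 ≤ n → AEMeasurable (X n) P)
    (hε : ∀ n, 1 ≤ n → HasLaw (ε n) (Measure.pi fun _ => gaussianReal 0 (σ₀ ^ 2)) P)
    (hXε : ∀ n, 1 ≤ n → IndepFun (X n) (ε n) P)
    (ν : ℝ) (hν : 0 < ν)
    (π : ∀ n : ℕ, PMF (Finset (Fin (p n)))) (C₀ : ℝ≥0)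
    (hπ : ∀ n, 1 ≤ n → ∀ γ, π n γ / π n ∅ ≤ C₀)
    (hp : Tendsto p atTop atTop)
    (hplog : (fun n => (p n : ℝ) * Real.log (p n)) =o[atTop] fun n => (n : ℝ))
    (φlow φup : ℕ → ℝ)
    (hlow : ∀ n, 1 ≤ n → 0 < φlow n) (hlowup : ∀ n, 1 ≤ n → φlow n ≤ φup n)
    (r : ℕ → ℝ) (hr : ∀ n, 1 ≤ n → 0 < r n)
    (hgram : WithHighProbability P atTop fun n ω =>
      GramBound (r n) (Matrix.of (X n ω))) :
    ((∃ α₀ : ℝ, 2 < α₀ ∧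
        (fun n => (p n : ℝ) ^ α₀) =o[atTop] fun n => r n * φlow n) →
      TendstoInMeasure P
        (fun n ω => supOdds (π n) ν (φlow n) (φup n) ∅
          (Matrix.of (X n ω)) (ε n ω)) atTop (fun _ => 0)) ∧
    ((∃ α₀ : ℝ, 2 < α₀ ∧
        (fun n => (p n : ℝ) ^ (α₀ + 2)) =o[atTop] fun n => r n * φlow n) →
      TendstoInMeasure P
        (fun n ω => supWrong (π n) ν (φlow n) (φup n) ∅
          (Matrix.of (X n ω)) (ε n ω)) atTop (fun _ => 0) ∧
      TendstoInMeasure P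
        (fun n ω => infTrue (π n) ν (φlow n) (φup n) ∅
          (Matrix.of (X n ω)) (ε n ω)) atTop (fun _ => 1)) := by
  have hodds : ∀ α₀ : ℝ, 2 < α₀ → WithHighProbability P atTop fun n ω =>
      GeometricOdds (π n) ν (φlow n) (φup n) (Matrix.of (X n ω)) (ε n ω) C₀
        ((p n : ℝ) ^ (α₀ / 2) * (√(r n * φlow n))⁻¹) := fun α₀ hα₀ =>
    withHighProbability_geometricOdds (pow_pos hσ₀ 2).ne' hX hε hXε hν hπ hp hplog hlow hr hgram
      ((one_lt_div two_pos).mpr hα₀)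
  have hpn : ∀ n, 0 ≤ (p n : ℝ) := fun n => Nat.cast_nonneg (p n)
  have hratio : ∀ (α₀ : ℝ) (n : ℕ), 0 ≤ (p n : ℝ) ^ (α₀ / 2) * (√(r n * φlow n))⁻¹ :=
    fun α₀ n => by positivity
  constructor
  · rintro ⟨α₀, hα₀, hgrowth⟩
    exact tendstoInMeasure_supOdds (hratio α₀) (tendsto_rpow_half_mul_inv_sqrt hpn hgrowth)
      (hodds α₀ hα₀)
  · rintro ⟨α₀, hα₀, hgrowth⟩
    have hsum := tendsto_mul_rpow_half_mul_inv_sqrt hpn (two_pos.trans hα₀) hgrowth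
    exact ⟨tendstoInMeasure_supWrong (hratio α₀) hsum (hodds α₀ hα₀),
      tendstoInMeasure_infTrue ((eventually_ge_atTop 1).mono hlowup) (hratio α₀) hsum
        (hodds α₀ hα₀)⟩

theorem mainTheorem3
    {Ω : Type*} [MeasurableSpace Ω] (P : Measure Ω) [IsProbabilityMeasure P]
    -- dimension, design matrix, errors (the response is the error vector: null true model)
    (p : ℕ → ℕ)
    (X : ∀ n : ℕ, Ω → (Fin n → Fin (p n) → ℝ))
    (ε : ∀ n : ℕ, Ω → (Fin n → ℝ))
    (σ₀ : ℝ≥0) (hσ₀ : 0 < σ₀)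
    (hX : ∀ n, 1 ≤ n → AEMeasurable (X n) P)
    (hε : ∀ n, 1 ≤ n → HasLaw (ε n) (Measure.pi fun _ => gaussianReal 0 (σ₀ ^ 2)) P)
    (hXε : ∀ n, 1 ≤ n → IndepFun (X n) (ε n) P)
    -- the Bayesian model: degrees of freedom and prior on models
    (ν : ℝ) (hν : 0 < ν)
    (π : ∀ n : ℕ, PMF (Finset (Fin (p n))))
    -- bounded prior odds
    (C₀ : ℝ) (hC₀ : 0 < C₀)
    (hπ : ∀ n, 1 ≤ n → ∀ γ, π n γ / π n ∅ ≤ ENNReal.ofReal C₀)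
    -- growth of the dimension
    (hp : Tendsto p atTop atTop) (hpn : ∀ n, 1 ≤ n → p n ≤ n)
    (hplog : (fun n => (p n : ℝ) * Real.log (p n)) =o[atTop] fun n => (n : ℝ))
    -- range of the hyperparameters
    (φlow φup : ℕ → ℝ)
    (hlow : ∀ n, 1 ≤ n → 0 < φlow n) (hlowup : ∀ n, 1 ≤ n → φlow n ≤ φup n)
    (δ₀ : ℝ) (hδ₀ : 0 < δ₀) (hup : φup =O[atTop] fun n => (n : ℝ) ^ δ₀)
    -- eigenvalue condition on the design
    (C₃ δ : ℝ) (hC₃ : 0 < C₃) (hδ : 0 ≤ δ)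
    (hrate : Tendsto (fun n : ℕ => (n : ℝ) ^ (1 - δ) * φlow n) atTop atTop)
    (heig : ∀ n, 1 ≤ n → ∀ᵐ ω ∂P, ∀ γ : Finset (Fin (p n)), ∅ ⊆ γ → γ ≠ ∅ →
      C₃ * (n : ℝ) ^ (-δ) ≤
        BayesSelection.minEigenvalue
          (BayesSelection.residualGram (Matrix.of (X n ω)) ∅ γ)) :
    ((∃ α₀ : ℝ, 2 < α₀ ∧
        (fun n => (p n : ℝ) ^ α₀) =o[atTop] fun n => (n : ℝ) ^ (1 - δ) * φlow n) →
      TendstoInMeasure P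
        (fun n ω => BayesSelection.supOdds (π n) ν (φlow n) (φup n) ∅
          (Matrix.of (X n ω)) (ε n ω)) atTop (fun _ => 0)) ∧
    ((∃ α₀ : ℝ, 2 < α₀ ∧
        (fun n => (p n : ℝ) ^ (α₀ + 2)) =o[atTop] fun n => (n : ℝ) ^ (1 - δ) * φlow n) →
      TendstoInMeasure P
        (fun n ω => BayesSelection.supWrong (π n) ν (φlow n) (φup n) ∅
          (Matrix.of (X n ω)) (ε n ω)) atTop (fun _ => 0) ∧
      TendstoInMeasure P
        (fun n ω => BayesSelection.infTrue (π n) ν (φlow n) (φup n) ∅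
          (Matrix.of (X n ω)) (ε n ω)) atTop (fun _ => 1)) := by
  simpa only [mul_assoc, isLittleO_const_mul_right_iff hC₃.ne'] using
    mainTheorem3_general P p X ε σ₀ hσ₀ hX hε hXε ν hν π C₀.toNNReal hπ hp hplog φlow φup hlow
      hlowup (fun n => C₃ * (n : ℝ) ^ (1 - δ))
      (fun n hn => mul_pos hC₃ (Real.rpow_pos_of_pos (Nat.cast_pos.mpr hn) _))
      (.of_eventually_ae ((eventually_ge_atTop 1).mono fun n hn => (heig n hn).mono fun _ h =>
        BayesSelection.gramBound_rpow_of_le_minEigenvalue hn fun γ => h γ (Finset.empty_subset γ)))
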